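/- Let $k$ be a field of characteristic $p>0$ that is finitely generated over $k^p$, let $R=k[x_0,\dots,x_n]$, $\mathfrak m=(x_0,\dots,x_n)$, and let $f\in R$ be homogeneous of degree $d$. For an ideal $I$ of $R$ put $I^{[p^e]}=(u^{p^e}\mid u\in I)$, and let $\tau=\tau(f^{1-1/p})$ be the smallest ideal $\mathfrak a\subseteq R$ with $f^{p-1}\in\mathfrak a^{[p]}$. A ring of characteristic $p$ is F-pure if its Frobenius map is pure. We say that $R/fR$ has an isolated non-F-pure point at $\mathfrak m$ if $(R/fR)_{\mathfrak m}$ is not F-pure but $(R/fR)_{\mathfrak p}$ is F-pure for every prime $\mathfrak p\subsetneq\mathfrak m$. Let $M_e\in\mathbb N\cup\{\infty\}$ be the least degree of a homogeneous element of $(\mathfrak m^{[p^e]}:\tau)\setminus\mathfrak m^{[p^e]}$. (1) Suppose that $R/fR$ has an isolated non-F-pure point at $\mathfrak m$. Then $M_e-(n+1)p^e$ is finite and takes a constant value $\delta(f)\in\mathbb Z$ for all $e\gg0$, and the Frobenius action $$F:H^n_{\mathfrak m}(R/fR)_{<\delta(f)+d}\to H^n_{\mathfrak m}(R/fR)_{<p(\delta(f)+d)}$$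 is injective. The bound is sharp: there is a nonzero $\xi\in H^n_{\mathfrak m}(R/fR)_{\delta(f)+d}$ with $F(\xi)=0$. (2) If $\tau=\mathfrak m^j$ for some $j\ge1$, then $R/fR$ has an isolated non-F-pure point at $\mathfrak m$ and $\delta(f)=-n-j$; in particular $$F:H^n_{\mathfrak m}(R/fR)_{<-n-j+d}\to H^n_{\mathfrak m}(R/fR)_{<p(-n-j+d)}$$ is injective. -/

import Mathlib

open scoped TensorProduct

universe u

noncomputable section

namespace FPureHyp

/-! ### Frobenius and F-purity -/

section FPure

/-- The Frobenius endomorphism `a ↦ a ^ p` of a commutative ring in which the prime `p` is zero.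
(The zero ring is allowed; localizations below may vanish.) -/
def frob (p : ℕ) [hp : Fact p.Prime] (A : Type*) [CommRing A] (hA : (p : A) = 0) : A →+* A where
  toFun a := a ^ p
  map_one' := one_pow p
  map_mul' a b := mul_pow a b p
  map_zero' := zero_pow hp.out.ne_zero
  map_add' a b := by
    obtain ⟨r, hr⟩ := exists_add_pow_prime_eq hp.out a b
    rw [hr, hA]; ring

/-- A ring homomorphism `φ : A → B` is pure if `M → B ⊗[A] M`, `m ↦ 1 ⊗ m`, is injective for
every `A`-module `M`. -/
def IsPure {A B : Type u} [CommRing A] [CommRing B] (φ : A →+* B) : Prop :=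
  letI : Algebra A B := φ.toAlgebra
  ∀ (M : Type u) [AddCommGroup M] [Module A M],
    Function.Injective fun m : M => (1 : B) ⊗ₜ[A] m

/-- A ring `A` in which the prime `p` is zero is F-pure if its Frobenius map is pure. -/
def IsFPure (p : ℕ) [Fact p.Prime] (A : Type u) [CommRing A] : Prop :=
  ∃ hA : (p : A) = 0, IsPure (frob p A hA)

end FPure

/-! ### Čech (local) cohomology of a ring with respect to a finite sequence of elements

For a sequence `x₀, …, x_{m-1}` in `A` we use the Čech complex
`0 → A → ∏ A_{x_i} → ∏ A_{x_i x_j} → ⋯ → A_{x₀ ⋯ x_{m-1}} → 0`, whose cohomology is the local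
cohomology of `A` with support in the ideal generated by the `x_i` (for `A` Noetherian). -/

section Cech

variable {A : Type*} [CommRing A] {m : ℕ} (x : Fin m → A)

/-- `A_I`, the ring `A` with `∏_{i ∈ I} x_i` inverted. -/
abbrev Loc (I : Finset (Fin m)) : Type _ := Localization.Away (∏ i ∈ I, x i)

/-- The canonical map `A_I → A_J` for `I ⊆ J`. -/
def res {I J : Finset (Fin m)} (h : I ⊆ J) : Loc x I →+* Loc x J :=
  IsLocalization.Away.lift (S := Loc x I) (g := algebraMap A (Loc x J)) (∏ i ∈ I, x i)
    (isUnit_of_dvd_unit (map_dvd _ (Finset.prod_dvd_prod_of_subset I J x h))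
      (IsLocalization.Away.algebraMap_isUnit (∏ i ∈ J, x i)))

lemma res_algebraMap {I J : Finset (Fin m)} (h : I ⊆ J) (a : A) :
    res x h (algebraMap A (Loc x I) a) = algebraMap A (Loc x J) a :=
  IsLocalization.Away.lift_eq _ _ a

lemma res_smul {I J : Finset (Fin m)} (h : I ⊆ J) (a : A) (c : Loc x I) :
    res x h (a • c) = a • res x h c := by
  rw [Algebra.smul_def, Algebra.smul_def, map_mul, res_algebraMap]

/-- Čech cochains of degree `q`: families of elements of the `A_I` with `|I| = q`. -/
abbrev Cochain (q : ℕ) : Type _ := (I : {I : Finset (Fin m) // I.card = q}) → Loc x I.1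

/-- The Čech differential: the component of `d c` at `J` is the sum over `j ∈ J` of the restrictions
of `c_{J \ {j}}`, with sign `(-1)` to the power of the position of `j` in `J`. -/
def diff (q : ℕ) : Cochain x q →ₗ[A] Cochain x (q + 1) where
  toFun c J := ∑ j : {j // j ∈ J.1}, (-1) ^ (J.1.filter (· < j.1)).card *
    res x (Finset.erase_subset j.1 J.1)
      (c ⟨J.1.erase j.1, by rw [Finset.card_erase_of_mem j.2, J.2]; rfl⟩)
  map_add' c c' := by
    funext J
    simp only [Pi.add_apply, map_add, mul_add, Finset.sum_add_distrib]
  map_smul' a c := by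
    funext J
    simp only [Pi.smul_apply, res_smul, RingHom.id_apply, Finset.smul_sum, mul_smul_comm]

/-- Cocycles of degree `q`. -/
def cocycles (q : ℕ) : Submodule A (Cochain x q) := LinearMap.ker (diff x q)

/-- Coboundaries of degree `q`. -/
def coboundaries : (q : ℕ) → Submodule A (Cochain x q)
  | 0 => ⊥
  | q + 1 => LinearMap.range (diff x q)

/-- The `q`-th Čech cohomology `H^q` of `A` with respect to the sequence `x`. -/
abbrev Cohomology (q : ℕ) : Type _ :=
  cocycles x q ⧸ (coboundaries x q).submoduleOf (cocycles x q)

/-! The Frobenius action. -/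

lemma natCast_loc (p : ℕ) (hA : (p : A) = 0) (I : Finset (Fin m)) : (p : Loc x I) = 0 := by
  rw [← map_natCast (algebraMap A (Loc x I)), hA, map_zero]

variable (p : ℕ) [Fact p.Prime]

/-- The Frobenius on cochains: the `p`-th power map on every component. -/
def frobCochain (hA : (p : A) = 0) (q : ℕ) : Cochain x q →ₛₗ[frob p A hA] Cochain x q where
  toFun c I := frob p (Loc x I.1) (natCast_loc x p hA I.1) (c I)
  map_add' c c' := by
    funext I
    simp only [Pi.add_apply, map_add]
  map_smul' a c := by
    funext I
    simp only [Pi.smul_apply, Algebra.smul_def, map_mul]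
    congr 1
    simp [frob]

lemma diff_frobCochain (hA : (p : A) = 0) (q : ℕ) (c : Cochain x q) :
    diff x q (frobCochain x p hA q c) = frobCochain x p hA (q + 1) (diff x q c) := by
  funext J
  simp only [diff, frobCochain, LinearMap.coe_mk, AddHom.coe_mk, map_sum, map_mul, map_pow,
    map_neg, map_one]
  refine Finset.sum_congr rfl fun j _ => ?_
  congr 1
  simp [frob]

lemma frobCochain_mem_cocycles (hA : (p : A) = 0) (q : ℕ) (c : cocycles x q) :
    frobCochain x p hA q c.1 ∈ cocycles x q := by
  have h : diff x q c.1 = 0 := c.2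
  change diff x q _ = 0
  rw [diff_frobCochain, h, map_zero]

lemma frobCochain_mem_coboundaries (hA : (p : A) = 0) (q : ℕ) (c : Cochain x q)
    (hc : c ∈ coboundaries x q) : frobCochain x p hA q c ∈ coboundaries x q := by
  cases q with
  | zero =>
    have h : c = 0 := hc
    rw [h, map_zero]; exact Submodule.zero_mem _
  | succ q =>
    obtain ⟨b, rfl⟩ := hc
    exact ⟨frobCochain x p hA q b, diff_frobCochain x p hA q b⟩

/-- The Frobenius on cocycles. -/
def frobCocycles (hA : (p : A) = 0) (q : ℕ) : cocycles x q →ₛₗ[frob p A hA] cocycles x q :=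
  ((frobCochain x p hA q).comp (cocycles x q).subtype).codRestrict (cocycles x q)
    (frobCochain_mem_cocycles x p hA q)

/-- The Frobenius action `F : H^q → H^q`, induced by the `p`-th power map on cochains. -/
def frobCohomology (hA : (p : A) = 0) (q : ℕ) :
    Cohomology x q →ₛₗ[frob p A hA] Cohomology x q :=
  Submodule.mapQ _ _ (frobCocycles x p hA q) fun c hc =>
    frobCochain_mem_coboundaries x p hA q c.1 hc

/-! The grading, for a grading `𝒜` of `A` in which all the `x_i` have degree one. -/

variable (𝒜 : ℕ → AddSubgroup A)

/-- The degree `j` part of `A_I`: it is generated by the fractions `a / (∏_{i ∈ I} x_i) ^ N`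
with `a` homogeneous of degree `j + N |I|`. -/
def locDegree (j : ℤ) (I : Finset (Fin m)) : AddSubgroup (Loc x I) :=
  AddSubgroup.closure {c | ∃ (N r : ℕ) (a : A), a ∈ 𝒜 r ∧ (r : ℤ) = j + N * I.card ∧
    c = Localization.mk a ⟨(∏ i ∈ I, x i) ^ N, pow_mem (Submonoid.mem_powers _) N⟩}

/-- The degree `j` part of `H^q`: the classes of cocycles with all components of degree `j`. -/
def cohomologyDegree (q : ℕ) (j : ℤ) : AddSubgroup (Cohomology x q) :=
  AddSubgroup.map
    (Submodule.mkQ ((coboundaries x q).submoduleOf (cocycles x q))).toAddMonoidHom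
    { carrier := {c | ∀ I, c.1 I ∈ locDegree x 𝒜 j I.1}
      zero_mem' := fun _ => AddSubgroup.zero_mem _
      add_mem' := fun ha hb I => AddSubgroup.add_mem _ (ha I) (hb I)
      neg_mem' := fun ha I => AddSubgroup.neg_mem _ (ha I) }

/-- `H^q_{< N}`, the sum of the parts of `H^q` of degree less than `N`. -/
def cohomologyLT (q : ℕ) (N : ℤ) : AddSubgroup (Cohomology x q) :=
  ⨆ j : {j : ℤ // j < N}, cohomologyDegree x 𝒜 q j.1

end Cech

/-! ### Hypersurfaces `R/fR`, where `R = k[x₀, …, xₙ]` -/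

section Hypersurface

variable {k : Type u} [Field k] {n : ℕ}

/-- `R = k[x₀, …, xₙ]`. -/
abbrev Poly (k : Type u) [Field k] (n : ℕ) : Type u := MvPolynomial (Fin (n + 1)) k

/-- The homogeneous maximal ideal `𝔪 = (x₀, …, xₙ)` of `R`. -/
def maxIdeal (k : Type u) [Field k] (n : ℕ) : Ideal (Poly k n) :=
  Ideal.span (Set.range MvPolynomial.X)

instance maxIdeal_isPrime : (maxIdeal k n).IsPrime := by
  have h : maxIdeal k n = RingHom.ker (MvPolynomial.constantCoeff (R := k)) := by
    ext g
    rw [maxIdeal, ← Set.image_univ, MvPolynomial.mem_ideal_span_X_image, RingHom.mem_ker,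
      MvPolynomial.constantCoeff_eq]
    constructor
    · intro hg
      by_contra h0
      obtain ⟨i, -, hi⟩ := hg 0 (MvPolynomial.mem_support_iff.mpr h0)
      exact hi rfl
    · intro hg s hs
      by_contra! h
      have h0 : s = 0 := Finsupp.ext fun i => h i (Set.mem_univ i)
      rw [h0] at hs
      exact MvPolynomial.mem_support_iff.mp hs hg
  rw [h]; exact RingHom.ker_isPrime _

/-- The Frobenius power `I^{[p^e]}`, generated by the `u ^ (p ^ e)` with `u ∈ I`. -/
def frobPower {R : Type*} [CommRing R] (p : ℕ) (I : Ideal R) (e : ℕ) : Ideal R :=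
  Ideal.span ((fun u => u ^ p ^ e) '' (I : Set R))

/-- The test ideal `τ(f^{1 - 1/p^e})`: the smallest ideal `𝔞` with `f ^ (p ^ e - 1) ∈ 𝔞^{[p^e]}`. -/
def testIdeal (p : ℕ) (f : Poly k n) (e : ℕ) : Ideal (Poly k n) :=
  sInf {𝔞 | f ^ (p ^ e - 1) ∈ frobPower p 𝔞 e}

/-- The hypersurface ring `R/fR`. -/
abbrev Hyp (f : Poly k n) : Type u := Poly k n ⧸ Ideal.span {f}

/-- The localization `(R/fR)_P` at a prime ideal `P` of `R` (the zero ring if `f ∉ P`). -/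
abbrev HypLoc (f : Poly k n) (P : Ideal (Poly k n)) [P.IsPrime] : Type u :=
  Localization (P.primeCompl.map (Ideal.Quotient.mk (Ideal.span {f})))

/-- `R/fR` has an isolated non-F-pure point at `𝔪`: `(R/fR)_𝔪` is not F-pure, but `(R/fR)_P` is
for every prime `P ⊊ 𝔪`. -/
def IsolatedNonFPure (p : ℕ) [Fact p.Prime] (f : Poly k n) : Prop :=
  ¬ IsFPure p (HypLoc f (maxIdeal k n)) ∧
    ∀ (P : Ideal (Poly k n)) [P.IsPrime], P < maxIdeal k n → IsFPure p (HypLoc f P)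

/-- `M_e`, the least degree of a homogeneous element of `(𝔪^{[p^e]} : τ(f^{1 - 1/p}))` outside
`𝔪^{[p^e]}`, and `∞` if there is none. -/
def minDeg (p : ℕ) (f : Poly k n) (e : ℕ) : ℕ∞ :=
  sInf {r : ℕ∞ | ∃ (s : ℕ) (g : Poly k n), g.IsHomogeneous s ∧
    g ∈ (frobPower p (maxIdeal k n) e).colon (testIdeal p f 1 : Set (Poly k n)) ∧
    g ∉ frobPower p (maxIdeal k n) e ∧ r = s}

/-- `δ` is the stable value of the sequence `M_e - (n + 1) p ^ e`, that is, `M_e` is finite and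
`M_e - (n + 1) p ^ e = δ` for all sufficiently large `e`. -/
def IsDelta (p : ℕ) (f : Poly k n) (δ : ℤ) : Prop :=
  ∀ᶠ e : ℕ in Filter.atTop, ∃ M : ℕ, minDeg p f e = M ∧ (M : ℤ) - (n + 1) * p ^ e = δ

/-- The images of `x₀, …, xₙ` in `R/fR`. -/
def hypVar (f : Poly k n) (i : Fin (n + 1)) : Hyp f :=
  Ideal.Quotient.mk (Ideal.span {f}) (MvPolynomial.X i)

/-- The degree `r` part of `R/fR`, for `f` homogeneous. -/
def hypGrading (f : Poly k n) (r : ℕ) : AddSubgroup (Hyp f) :=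
  AddSubgroup.map (Ideal.Quotient.mk (Ideal.span {f})).toAddMonoidHom
    (MvPolynomial.homogeneousSubmodule (Fin (n + 1)) k r).toAddSubgroup

/-- The local cohomology module `H^q_𝔪(R/fR)`. -/
abbrev HypLC (f : Poly k n) (q : ℕ) : Type u := Cohomology (hypVar f) q

/-- `H^q_𝔪(R/fR)_j`. -/
abbrev hypLCDegree (f : Poly k n) (q : ℕ) (j : ℤ) : AddSubgroup (HypLC f q) :=
  cohomologyDegree (hypVar f) (hypGrading f) q j

/-- `H^q_𝔪(R/fR)_{< N}`. -/
abbrev hypLCLT (f : Poly k n) (q : ℕ) (N : ℤ) : AddSubgroup (HypLC f q) :=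
  cohomologyLT (hypVar f) (hypGrading f) q N

lemma natCast_hyp (p : ℕ) [CharP k p] (f : Poly k n) : (p : Hyp f) = 0 := by
  rw [← map_natCast (algebraMap k (Hyp f)), CharP.cast_eq_zero, map_zero]

/-- The Frobenius action on `H^q_𝔪(R/fR)`. -/
def hypFrob (p : ℕ) [Fact p.Prime] [CharP k p] (f : Poly k n) (q : ℕ) (ξ : HypLC f q) :
    HypLC f q :=
  frobCohomology (hypVar f) p (natCast_hyp p f) q ξ

end Hypersurface

end FPureHyp

end

/-!
For every prime `P` of `R`, Fedder's criterion says that `(R/fR)_P` fails to be F-pure exactly when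
`f ^ (p - 1) ∈ P^{[p]}`, that is, when `τ ⊆ P`. So an isolated non-F-pure point at `𝔪` means that
`τ` is a proper ideal containing a power of `𝔪`.

The connecting homomorphism of `0 → R(-d) → R → R/fR → 0` embeds `H^n_𝔪(R/fR)` into
`H^{n+1}_𝔪(R)(-d)`, with image the annihilator of `f`, and turns the Frobenius action into
`η ↦ f ^ (p - 1) F(η)`. A class `η = [g / (x₀ ⋯ xₙ) ^ p ^ e]` is killed exactly when
`f ^ (p - 1) g ^ p ∈ 𝔪^{[p ^ (e + 1)]} = (𝔪^{[p ^ e]})^{[p]}`, and by flatness of Frobenius this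
means `g τ ⊆ 𝔪^{[p ^ e]}`. Hence the kernel of Frobenius is the annihilator of `τ` in
`H^{n+1}_𝔪(R)(-d)`. Its lowest degree is `δ(f) + d`, because the homogeneous elements of
`(𝔪^{[p ^ e]} : τ) \ 𝔪^{[p ^ e]}` of degree `s` give its elements of degree `s - (n + 1) p ^ e + d`.
-/

noncomputable section

namespace FPureHyp

section FrobPower

variable {R : Type*} [CommRing R] (p : ℕ)

lemma frobPower_zero (I : Ideal R) : frobPower p I 0 = I := by
  simp [frobPower]

lemma frobPower_mono {I J : Ideal R} (h : I ≤ J) (e : ℕ) : frobPower p I e ≤ frobPower p J e :=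
  Ideal.span_mono (Set.image_mono h)

lemma pow_mem_frobPower_one {I : Ideal R} {u : R} (hu : u ∈ I) : u ^ p ∈ frobPower p I 1 :=
  Ideal.subset_span ⟨u, hu, by rw [pow_one]⟩

lemma frobPower_one_le [hp : Fact p.Prime] (I : Ideal R) : frobPower p I 1 ≤ I := by
  rw [frobPower, Ideal.span_le]
  rintro _ ⟨u, hu, rfl⟩
  exact I.pow_mem_of_mem hu _ (pow_pos hp.out.pos 1)

lemma frobPower_span [hp : Fact p.Prime] [CharP R p] (S : Set R) (e : ℕ) :
    frobPower p (Ideal.span S) e = Ideal.span ((· ^ p ^ e) '' S) := by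
  change Ideal.map (iterateFrobenius R p e) (Ideal.span S) = _
  rw [Ideal.map_span]
  rfl

lemma frobPower_frobPower [Fact p.Prime] [CharP R p] (I : Ideal R) (e e' : ℕ) :
    frobPower p (frobPower p I e) e' = frobPower p I (e + e') := by
  change frobPower p (Ideal.span _) e' = _
  rw [frobPower_span, Set.image_image]
  simp only [← pow_mul, ← pow_add]
  rfl

end FrobPower

section CartierLinear

variable {A : Type*} [CommRing A] {p : ℕ}

/-- `p⁻¹`-linear (Cartier-linear) maps `ψ : A → A`, that is, the `A`-linear maps `F_* A → A`. -/
def IsCartierLinear (p : ℕ) (ψ : A →+ A) : Prop :=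
  ∀ a b, ψ (a ^ p * b) = a * ψ b

namespace IsCartierLinear

variable {ψ : A →+ A}

lemma map_mul_pow (h : IsCartierLinear p ψ) (a b : A) : ψ (b * a ^ p) = a * ψ b := by
  rw [mul_comm, h]

lemma mulLeft_comp (h : IsCartierLinear p ψ) (c : A) :
    IsCartierLinear p ((AddMonoidHom.mulLeft c).comp ψ) := fun a b => by
  simp only [AddMonoidHom.comp_apply, AddMonoidHom.coe_mulLeft, h a b, mul_left_comm c]

lemma comp_mulLeft (h : IsCartierLinear p ψ) (c : A) :
    IsCartierLinear p (ψ.comp (AddMonoidHom.mulLeft c)) := fun a b => by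
  simp only [AddMonoidHom.comp_apply, AddMonoidHom.coe_mulLeft, mul_left_comm c, h a]

lemma sum {κ : Type*} {s : Finset κ} {φ : κ → A →+ A} (h : ∀ i ∈ s, IsCartierLinear p (φ i)) :
    IsCartierLinear p (∑ i ∈ s, φ i) := fun a b => by
  simp only [AddMonoidHom.finsetSum_apply, Finset.mul_sum]
  exact Finset.sum_congr rfl fun i hi => h i hi a b

lemma mem_of_mem_frobPower (h : IsCartierLinear p ψ) {I : Ideal A} {b : A}
    (hb : b ∈ frobPower p I 1) : ψ b ∈ I := by
  rw [frobPower, pow_one] at hb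
  induction hb using Submodule.span_induction generalizing ψ with
  | mem _ hu =>
    obtain ⟨u, hu, rfl⟩ := hu
    rw [← mul_one ((fun u => u ^ p) u), h]
    exact I.mul_mem_right _ hu
  | zero => rw [map_zero]; exact I.zero_mem
  | add x y _ _ hx hy => rw [map_add]; exact I.add_mem (hx h) (hy h)
  | smul a _ _ hx => exact hx (h.comp_mulLeft a)

/-- The value of the extension of `ψ` to a localization on the fraction `b / s`, computed by
rewriting it as `s ^ (p - 1) b / s ^ p`. -/
def localizedValue (p : ℕ) (ψ : A →+ A) {S : Submonoid A} (b : A) (s : S) : Localization S :=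
  Localization.mk (ψ ((s : A) ^ (p - 1) * b)) s

lemma localizedValue_congr (h : IsCartierLinear p ψ) (hp : p ≠ 0) {S : Submonoid A} {b b' : A}
    {s s' : S} (hr : Localization.r S (b, s) (b', s')) :
    localizedValue p ψ b s = localizedValue p ψ b' s' := by
  obtain ⟨c, hc⟩ := Localization.r_iff_exists.mp hr
  simp only at hc
  rw [localizedValue, localizedValue, Localization.mk_eq_mk_iff, Localization.r_iff_exists]
  refine ⟨c, ?_⟩
  dsimp only
  rw [← h, ← h, ← h, ← h, ← mul_pow_sub_one hp (s : A), ← mul_pow_sub_one hp (s' : A),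
    ← mul_pow_sub_one hp (c : A)]
  congr 1
  linear_combination (c : A) ^ (p - 1) * (s : A) ^ (p - 1) * (s' : A) ^ (p - 1) * hc

lemma exists_localization (h : IsCartierLinear p ψ) (hp : p ≠ 0) (S : Submonoid A) :
    ∃ Ψ : Localization S →+ Localization S, IsCartierLinear p Ψ ∧
      Ψ 1 = algebraMap A (Localization S) (ψ 1) := by
  let Ψ₀ (z : Localization S) : Localization S :=
    z.liftOn (localizedValue p ψ) (h.localizedValue_congr hp)
  have hΨ₀ (b : A) (s : S) : Ψ₀ (Localization.mk b s) =
    Localization.mk (ψ ((s : A) ^ (p - 1) * b)) s := Localization.liftOn_mk _ _ _ _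
  refine ⟨AddMonoidHom.mk' Ψ₀ fun y z => ?_, fun y z => ?_, ?_⟩
  · induction y, z using Localization.induction_on₂ with | H y z => ?_
    obtain ⟨b, s⟩ := y
    obtain ⟨b', s'⟩ := z
    simp only [Localization.add_mk, hΨ₀, Submonoid.coe_mul]
    congr 1
    rw [← h, ← h, ← map_add, ← mul_pow_sub_one hp (s : A), ← mul_pow_sub_one hp (s' : A)]
    congr 1
    ring
  · induction y, z using Localization.induction_on₂ with | H y z => ?_
    obtain ⟨a, t⟩ := y
    obtain ⟨b, s⟩ := z
    simp only [AddMonoidHom.mk'_apply, Localization.mk_pow, Localization.mk_mul, hΨ₀]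
    rw [Localization.mk_eq_mk_iff, Localization.r_iff_exists]
    refine ⟨1, ?_⟩
    simp only [Submonoid.coe_mul, OneMemClass.coe_one, one_mul, SubmonoidClass.coe_pow]
    have : ((t : A) ^ p * s) ^ (p - 1) * (a ^ p * b) =
        ((t : A) ^ (p - 1) * a) ^ p * ((s : A) ^ (p - 1) * b) := by ring
    rw [this, h, ← mul_pow_sub_one hp (t : A)]
    ring
  · rw [AddMonoidHom.mk'_apply, ← Localization.mk_one, hΨ₀, ← Localization.mk_one_eq_algebraMap]
    simp

end IsCartierLinear

end CartierLinear

section DualBasis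

lemma exists_dualBasis_of_field {A B : Type u} [Field A] [CommRing B] (φ : A →+* B) :
    ∃ (ι : Type u) (v : ι → B) (c : B →+ ι →₀ A), (∀ a b, c (φ a * b) = a • c b) ∧
      ∀ b, ((c b).sum fun i x => φ x * v i) = b := by
  let _ := φ.toAlgebra
  let v := Module.Basis.ofVectorSpace A B
  refine ⟨_, v, v.repr.toLinearMap.toAddMonoidHom, fun a b => ?_, fun b => ?_⟩
  · exact (congrArg v.repr (Algebra.smul_def a b).symm).trans (map_smul v.repr a b)
  · conv_rhs => rw [← v.linearCombination_repr b]
    exact Finsupp.sum_congr fun i _ => (Algebra.smul_def _ _).symm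

/-- A dual basis of `F_* R` over `R`: vectors `vec i` and `R`-linear coordinates `F_* R → R`, only
finitely many nonzero at each element, with `b = ∑ i, coord b i • vec i` for all `b`. The vectors
need not be independent. By the dual basis lemma it exists exactly if `F_* R` is projective. -/
structure FrobeniusDualBasis (p : ℕ) (R : Type*) [CommRing R] (ι : Type*) where
  vec : ι → R
  coord : R →+ ι →₀ R
  coord_pow_mul : ∀ a b, coord (a ^ p * b) = a • coord b
  sum_coord : ∀ b, ((coord b).sum fun i c => c ^ p * vec i) = b

namespace FrobeniusDualBasis

variable {p : ℕ} {R ι : Type*} [CommRing R]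

section

variable (B : FrobeniusDualBasis p R ι)

/-- The `i`-th coordinate, as a map `R → R`. -/
def coordAt (i : ι) : R →+ R :=
  (Finsupp.applyAddHom i).comp B.coord

lemma isCartierLinear_coordAt (i : ι) : IsCartierLinear p (B.coordAt i) := fun a b =>
  DFunLike.congr_fun (B.coord_pow_mul a b) i

lemma sum_coordAt [hp : Fact p.Prime] {s : Finset ι} {b : R} (hs : (B.coord b).support ⊆ s) :
    ∑ i ∈ s, B.coordAt i b ^ p * B.vec i = b := by
  conv_rhs => rw [← B.sum_coord b]
  exact (Finsupp.sum_of_support_subset _ hs (fun i c => c ^ p * B.vec i) fun i _ => by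
    rw [zero_pow hp.out.ne_zero, zero_mul]).symm

lemma mem_frobPower_iff {J : Ideal R} {b : R} :
    b ∈ frobPower p J 1 ↔ ∀ i, B.coordAt i b ∈ J := by
  refine ⟨fun h i => (B.isCartierLinear_coordAt i).mem_of_mem_frobPower h, fun h => ?_⟩
  rw [← B.sum_coord b]
  exact Ideal.sum_mem _ fun i _ => Ideal.mul_mem_right _ _ (pow_mem_frobPower_one p (h i))

end

lemma exists_of_field (k : Type u) [Field k] (p : ℕ) [Fact p.Prime] [CharP k p] :
    ∃ ι : Type u, Nonempty (FrobeniusDualBasis p k ι) := by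
  obtain ⟨ι, v, c, hc, hv⟩ := exists_dualBasis_of_field (frobenius k p)
  exact ⟨ι, ⟨⟨v, c, hc, hv⟩⟩⟩

section MvPolynomial

open MvPolynomial

variable {σ : Type*}

/-- The exponent vector of the remainders modulo `p`. -/
def expMod (p : ℕ) (u : σ →₀ ℕ) : σ →₀ ℕ := u.mapRange (· % p) (Nat.zero_mod p)

/-- The exponent vector of the quotients by `p`. -/
def expDiv (p : ℕ) (u : σ →₀ ℕ) : σ →₀ ℕ := u.mapRange (· / p) (Nat.zero_div p)

lemma nsmul_expDiv_add_expMod (u : σ →₀ ℕ) : p • expDiv p u + expMod p u = u :=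
  Finsupp.ext fun i => Nat.div_add_mod (u i) p

lemma expMod_nsmul_add (w u : σ →₀ ℕ) : expMod p (p • w + u) = expMod p u :=
  Finsupp.ext fun i => Nat.mul_add_mod p (w i) (u i)

lemma expDiv_nsmul_add (hp : 0 < p) (w u : σ →₀ ℕ) : expDiv p (p • w + u) = w + expDiv p u :=
  Finsupp.ext fun i => Nat.mul_add_div hp (w i) (u i)

variable {k : Type*} [CommRing k] (B : FrobeniusDualBasis p k ι)

/-- The coordinates of the terms with exponent `u` in the dual basis `mvPolynomial` below. -/
def monomialCoord (u : σ →₀ ℕ) : k →+ ι × (σ →₀ ℕ) →₀ MvPolynomial σ k :=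
  (Finsupp.mapDomain.addMonoidHom fun i => (i, expMod p u)).comp
    ((Finsupp.mapRange.addMonoidHom (monomial (expDiv p u)).toAddMonoidHom).comp B.coord)

/-- The coordinates of polynomials in the dual basis `mvPolynomial` below. -/
def mvPolynomialCoord : MvPolynomial σ k →+ ι × (σ →₀ ℕ) →₀ MvPolynomial σ k :=
  (Finsupp.liftAddHom B.monomialCoord).comp
    (basisMonomials σ k).repr.toLinearMap.toAddMonoidHom

lemma mvPolynomialCoord_monomial (u : σ →₀ ℕ) (s : k) :
    B.mvPolynomialCoord (monomial u s) =
      ((B.coord s).mapRange (monomial (expDiv p u)) (map_zero _)).mapDomain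
        fun i => (i, expMod p u) := by
  have : (basisMonomials σ k).repr (monomial u s) = Finsupp.single u s := rfl
  simp [mvPolynomialCoord, this, monomialCoord]

lemma mvPolynomialCoord_pow_mul [hp : Fact p.Prime] [CharP k p] (a b : MvPolynomial σ k) :
    B.mvPolynomialCoord (a ^ p * b) = a • B.mvPolynomialCoord b := by
  induction a using MvPolynomial.induction_on' with
  | add a₁ a₂ h₁ h₂ => rw [add_pow_char, add_mul, map_add, h₁, h₂, add_smul]
  | monomial w t =>
    induction b using MvPolynomial.induction_on' with
    | add b₁ b₂ h₁ h₂ => rw [mul_add, map_add, h₁, h₂, map_add, smul_add]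
    | monomial u s =>
      rw [monomial_pow, monomial_mul, mvPolynomialCoord_monomial, mvPolynomialCoord_monomial,
        expMod_nsmul_add, expDiv_nsmul_add hp.out.pos, B.coord_pow_mul, ← Finsupp.mapDomain_smul]
      congr 1
      ext1 i
      simp [monomial_mul]

lemma sum_mvPolynomialCoord [hp : Fact p.Prime] [CharP k p] (b : MvPolynomial σ k) :
    ((B.mvPolynomialCoord b).sum fun i c => c ^ p * monomial i.2 (B.vec i.1)) = b := by
  induction b using MvPolynomial.induction_on' with
  | add b₁ b₂ h₁ h₂ =>
    rw [map_add, Finsupp.sum_add_index', h₁, h₂]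
    · simp [hp.out.ne_zero]
    · intro i c c'
      rw [add_pow_char, add_mul]
  | monomial u s =>
    have h (i : ι) (c : k) : (monomial (expDiv p u) c) ^ p * monomial (expMod p u) (B.vec i) =
        monomial u (c ^ p * B.vec i) := by
      rw [monomial_pow, monomial_mul, nsmul_expDiv_add_expMod]
    rw [mvPolynomialCoord_monomial, Finsupp.sum_mapDomain_index, Finsupp.sum_mapRange_index]
    · simp only [h]
      rw [← map_finsuppSum, B.sum_coord]
    · simp [hp.out.ne_zero]
    · simp [hp.out.ne_zero]
    · intro i c c'
      rw [add_pow_char, add_mul]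

/-- The dual basis of a polynomial ring formed by the products `b X ^ a` with `b` in a dual basis of
the coefficient ring. The coordinates with some `a i ≥ p` vanish. -/
def mvPolynomial [Fact p.Prime] [CharP k p] :
    FrobeniusDualBasis p (MvPolynomial σ k) (ι × (σ →₀ ℕ)) where
  vec i := monomial i.2 (B.vec i.1)
  coord := B.mvPolynomialCoord
  coord_pow_mul := B.mvPolynomialCoord_pow_mul
  sum_coord := B.sum_mvPolynomialCoord

lemma isHomogeneous_coordAt_monomial [hp : Fact p.Prime] [CharP k p] (i : ι × (σ →₀ ℕ))
    (u : σ →₀ ℕ) (s : k) :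
    (B.mvPolynomial.coordAt i (monomial u s)).IsHomogeneous ((u.degree - i.2.degree) / p) := by
  obtain ⟨j, a⟩ := i
  change (B.mvPolynomialCoord (monomial u s) (j, a)).IsHomogeneous _
  rw [mvPolynomialCoord_monomial]
  by_cases ha : a = expMod p u
  · subst ha
    have hinj : Function.Injective fun i : ι => (i, expMod p u) := fun _ _ h => congrArg Prod.fst h
    have hdeg : (u.degree - (expMod p u).degree) / p = (expDiv p u).degree := by
      have := congrArg Finsupp.degree (nsmul_expDiv_add_expMod (p := p) u)
      rw [map_add, map_nsmul, smul_eq_mul] at this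
      rw [← this, Nat.add_sub_cancel, Nat.mul_div_cancel_left _ hp.out.pos]
    rw [Finsupp.mapDomain_apply hinj, hdeg]
    exact isHomogeneous_monomial _ rfl
  · rw [Finsupp.mapDomain_of_notMem_range]
    · exact isHomogeneous_zero _ _ _
    · rintro ⟨l, hl⟩
      exact ha (congrArg Prod.snd hl).symm

lemma isHomogeneous_coordAt [Fact p.Prime] [CharP k p] {g : MvPolynomial σ k} {D : ℕ}
    (hg : g.IsHomogeneous D) (i : ι × (σ →₀ ℕ)) :
    (B.mvPolynomial.coordAt i g).IsHomogeneous ((D - i.2.degree) / p) := by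
  rw [g.as_sum, map_sum]
  refine IsHomogeneous.sum _ _ _ fun u hu => ?_
  rw [hg.degree_eq_sum_deg_support hu]
  exact B.isHomogeneous_coordAt_monomial i u _

end MvPolynomial

end FrobeniusDualBasis
end DualBasis

section Purity

variable {A B : Type u} [CommRing A] [CommRing B] {φ : A →+* B}

lemma IsPure.of_retraction (ψ : B →+ A) (hψ : ∀ a b, ψ (φ a * b) = a * ψ b) (h1 : ψ 1 = 1) :
    IsPure φ := by
  let _ : Algebra A B := φ.toAlgebra
  intro M _ _ m m' h
  let Ψ : B →ₗ[A] A :=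
    { ψ with
      map_smul' := fun a b => by
        change ψ (a • b) = a * ψ b
        rw [Algebra.smul_def]; exact hψ a b }
  have h' := congrArg (TensorProduct.lid A M ∘ Ψ.rTensor M) h
  have hΨ : Ψ 1 = 1 := h1
  simpa [hΨ] using h'

lemma IsPure.exists_solution (h : IsPure φ) {ι : Type*} {κ : Type u} [Fintype ι] [Finite κ]
    (c : ι → κ → A) (b : κ → A) (e : ι → B) (he : ∀ l, ∑ s, φ (c s l) * e s = φ (b l)) :
    ∃ a : ι → A, ∀ l, ∑ s, a s * c s l = b l := by
  classical
  have := Fintype.ofFinite κ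
  let _ : Algebra A B := φ.toAlgebra
  let q := (Submodule.span A (Set.range c)).mkQ
  have hq (v : κ → A) : q v = 0 ↔ ∃ a : ι → A, ∑ s, a s • c s = v := by
    rw [Submodule.mkQ_apply, Submodule.Quotient.mk_eq_zero,
      Submodule.mem_span_range_iff_exists_fun]
  have tmul_q (y : B) (v : κ → A) : y ⊗ₜ[A] q v = ∑ l, (φ (v l) * y) ⊗ₜ[A] q (Pi.single l 1) := by
    conv_lhs => rw [pi_eq_sum_univ' v, map_sum, TensorProduct.tmul_sum]
    refine Finset.sum_congr rfl fun l _ => ?_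
    rw [map_smul, ← TensorProduct.smul_tmul, Algebra.smul_def]
    rfl
  have hb : (1 : B) ⊗ₜ[A] q b = (1 : B) ⊗ₜ[A] (0 : (κ → A) ⧸ Submodule.span A (Set.range c)) := by
    have hc (s : ι) : q (c s) = 0 := (hq _).mpr ⟨Pi.single s 1, by simp [Pi.single_apply]⟩
    calc (1 : B) ⊗ₜ[A] q b = ∑ l, (∑ s, φ (c s l) * e s) ⊗ₜ[A] q (Pi.single l 1) := by
          rw [tmul_q]; simp only [mul_one, he]
      _ = ∑ s, e s ⊗ₜ[A] q (c s) := by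
          simp only [TensorProduct.sum_tmul, tmul_q _ (c _)]
          exact Finset.sum_comm
      _ = _ := by simp [hc]
  obtain ⟨a, ha⟩ := (hq b).mp (h _ hb)
  exact ⟨a, fun l => by simpa using congrFun ha l⟩

lemma IsCartierLinear.isFPure_localization {p : ℕ} [hp : Fact p.Prime] {ψ : A →+ A}
    (h : IsCartierLinear p ψ) (hA : (p : A) = 0) {S : Submonoid A} (h1 : ψ 1 ∈ S) :
    IsFPure p (Localization S) := by
  obtain ⟨Ψ, hΨ, hΨ1⟩ := h.exists_localization hp.out.ne_zero S
  obtain ⟨v, hv⟩ := (IsLocalization.map_units (Localization S) ⟨_, h1⟩).exists_left_inv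
  refine ⟨by rw [← map_natCast (algebraMap A (Localization S)), hA, map_zero],
    IsPure.of_retraction ((AddMonoidHom.mulLeft v).comp Ψ) (hΨ.mulLeft_comp v) ?_⟩
  change v * Ψ 1 = 1
  rw [hΨ1, hv]

end Purity

section Fedder

/-- The localization `(R/fR)_P` of a hypersurface; `HypLoc` is the case of a polynomial ring. -/
abbrev QuotLoc {R : Type u} [CommRing R] (f : R) (P : Ideal R) [P.IsPrime] : Type u :=
  Localization (P.primeCompl.map (Ideal.Quotient.mk (Ideal.span {f})))

variable {R : Type u} [CommRing R] {p : ℕ} {f : R} {P : Ideal R} [P.IsPrime]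

namespace QuotLoc

lemma algebraMap_self : algebraMap R (QuotLoc f P) f = 0 := by
  rw [IsScalarTower.algebraMap_apply R (R ⧸ Ideal.span {f}), Ideal.Quotient.algebraMap_eq,
    Ideal.Quotient.eq_zero_iff_mem.mpr (Ideal.mem_span_singleton_self f), map_zero]

lemma exists_dvd_mul_of_algebraMap_eq_zero {x : R} (h : algebraMap R (QuotLoc f P) x = 0) :
    ∃ t ∉ P, f ∣ t * x := by
  rw [IsScalarTower.algebraMap_apply R (R ⧸ Ideal.span {f}), Ideal.Quotient.algebraMap_eq,
    IsLocalization.map_eq_zero_iff (P.primeCompl.map (Ideal.Quotient.mk (Ideal.span {f})))] at h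
  obtain ⟨⟨_, t, ht, rfl⟩, h⟩ := h
  refine ⟨t, ht, ?_⟩
  rwa [← map_mul, Ideal.Quotient.eq_zero_iff_mem, Ideal.mem_span_singleton] at h

lemma exists_forall_dvd_mul {κ : Type*} [Finite κ] {x : κ → R}
    (h : ∀ l, algebraMap R (QuotLoc f P) (x l) = 0) : ∃ t ∉ P, ∀ l, f ∣ t * x l := by
  have := Fintype.ofFinite κ
  choose r hrP hr using fun l => exists_dvd_mul_of_algebraMap_eq_zero (h l)
  refine ⟨∏ l, r l, fun hP => ?_, fun l => (hr l).trans
    (mul_dvd_mul_right (Finset.dvd_prod_of_mem r (Finset.mem_univ l)) _)⟩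
  obtain ⟨l, -, hl⟩ := Ideal.IsPrime.prod_mem_iff.mp hP
  exact hrP l hl

lemma exists_denominator {ι : Type*} [Finite ι] (a : ι → QuotLoc f P) :
    ∃ t ∉ P, ∃ α : ι → R, ∀ i,
      algebraMap R (QuotLoc f P) t * a i = algebraMap R (QuotLoc f P) (α i) := by
  obtain ⟨⟨_, t, ht, rfl⟩, h⟩ := IsLocalization.exist_integer_multiples_of_finite
    (P.primeCompl.map (Ideal.Quotient.mk (Ideal.span {f}))) a
  choose β hβ using h
  choose α hα using fun i => Ideal.Quotient.mk_surjective (β i)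
  refine ⟨t, ht, α, fun i => ?_⟩
  simp only [IsScalarTower.algebraMap_apply R (R ⧸ Ideal.span {f}), Ideal.Quotient.algebraMap_eq]
  rw [hα, hβ, Algebra.smul_def]

end QuotLoc

variable [hp : Fact p.Prime]

lemma IsCartierLinear.isFPure_quotLoc [CharP R p] {ψ : R →+ R} (h : IsCartierLinear p ψ)
    (hf : ∀ b, f ∣ ψ (f * b)) (h1 : ψ 1 ∉ P) : IsFPure p (QuotLoc f P) := by
  let I : Ideal R := Ideal.span {f}
  let ψ' : R ⧸ I →+ R ⧸ I := QuotientAddGroup.map I.toAddSubgroup I.toAddSubgroup ψ (by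
    intro x hx
    obtain ⟨b, rfl⟩ := Ideal.mem_span_singleton.mp hx
    exact Ideal.mem_span_singleton.mpr (hf b))
  have hψ' (x : R) : ψ' (Ideal.Quotient.mk I x) = Ideal.Quotient.mk I (ψ x) := rfl
  have hlin : IsCartierLinear p ψ' := fun a b => by
    obtain ⟨a, rfl⟩ := Ideal.Quotient.mk_surjective a
    obtain ⟨b, rfl⟩ := Ideal.Quotient.mk_surjective b
    rw [← map_pow, ← map_mul, hψ', h, map_mul, ← hψ']
  have hzero : (p : R ⧸ I) = 0 := by
    rw [← map_natCast (Ideal.Quotient.mk I), CharP.cast_eq_zero, map_zero]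
  refine hlin.isFPure_localization hzero ?_
  rw [← map_one (Ideal.Quotient.mk I), hψ']
  exact ⟨ψ 1, h1, rfl⟩

namespace FrobeniusDualBasis

variable {ι : Type*} (B : FrobeniusDualBasis p R ι)
include B

lemma isFPure_quotLoc_zero [CharP R p] : IsFPure p (QuotLoc (0 : R) P) := by
  have h1 : (1 : R) ∉ frobPower p P 1 := fun h => P.one_notMem (frobPower_one_le p P h)
  rw [B.mem_frobPower_iff, not_forall] at h1
  obtain ⟨i, hi⟩ := h1
  exact (B.isCartierLinear_coordAt i).isFPure_quotLoc (by simp) hi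

lemma isFPure_quotLoc [CharP R p] (h : f ^ (p - 1) ∉ frobPower p P 1) :
    IsFPure p (QuotLoc f P) := by
  rw [B.mem_frobPower_iff, not_forall] at h
  obtain ⟨i, hi⟩ := h
  have hlin := B.isCartierLinear_coordAt i
  refine (hlin.comp_mulLeft (f ^ (p - 1))).isFPure_quotLoc (fun b => ?_) (by simpa using hi)
  rw [AddMonoidHom.comp_apply, AddMonoidHom.coe_mulLeft, ← mul_assoc,
    pow_sub_one_mul hp.out.ne_zero, hlin]
  exact dvd_mul_right _ _

/- The `p`-th roots `z.2` of the `z.1` solve a linear system over `(R/fR)_P`, in the unknowns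
`vec i`, after extension of scalars along Frobenius. -/
lemma exists_isCartierLinear_of_isFPure (h : IsFPure p (QuotLoc f P)) (S : Finset (R × R))
    (hS : ∀ z ∈ S, algebraMap R (QuotLoc f P) z.1 = algebraMap R (QuotLoc f P) z.2 ^ p) :
    ∃ ψ : R →+ R, IsCartierLinear p ψ ∧ ∃ t ∉ P, ∀ z ∈ S, f ∣ ψ z.1 - t * z.2 := by
  classical
  obtain ⟨hA, hpure⟩ := h
  let η := algebraMap R (QuotLoc f P)
  let s : Finset ι := S.biUnion fun z => (B.coord z.1).support
  have hsum (z : S) : ∑ i : s, η (B.coordAt i z.1.1) ^ p * η (B.vec i) = η z.1.2 ^ p := by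
    simp only [← map_pow, ← map_mul, ← map_sum]
    rw [Finset.sum_coe_sort s fun i => B.coordAt i z.1.1 ^ p * B.vec i,
      B.sum_coordAt (Finset.subset_biUnion_of_mem (fun z : R × R => (B.coord z.1).support) z.2),
      hS _ z.2, map_pow]
  obtain ⟨a, ha⟩ := hpure.exists_solution (κ := S) (fun (i : s) z => η (B.coordAt i z.1.1))
    (fun z => η z.1.2) (fun i => η (B.vec i)) hsum
  obtain ⟨t, ht, α, hα⟩ := QuotLoc.exists_denominator a
  have hzero (z : S) : η (∑ i, α i * B.coordAt i z.1.1 - t * z.1.2) = 0 := by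
    simp only [map_sub, map_sum, map_mul, η, ← hα, mul_assoc, ← Finset.mul_sum]
    rw [ha, sub_self]
  obtain ⟨r, hr, hdvd⟩ := QuotLoc.exists_forall_dvd_mul hzero
  refine ⟨∑ i, (AddMonoidHom.mulLeft (r * α i)).comp (B.coordAt i),
    .sum fun i _ => (B.isCartierLinear_coordAt i).mulLeft_comp _, r * t,
    P.primeCompl.mul_mem hr ht, fun z hz => ?_⟩
  have := hdvd ⟨z, hz⟩
  rw [mul_sub, Finset.mul_sum] at this
  simpa [AddMonoidHom.finsetSum_apply, mul_assoc] using this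

/- Purity provides a Cartier-linear `ψ` with `ψ 1 ∉ P` and `ψ (f * vec i) ∈ fR` for those `i` that
occur in `f ^ (p - 1)`. If the coordinates of `f ^ (p - 1)` were in `P`, then
`f * ψ 1 = ψ (f * f ^ (p - 1))` would be in `f P`. -/
lemma notMem_frobPower_of_isFPure (hf : f ∈ nonZeroDivisors R) (h : IsFPure p (QuotLoc f P)) :
    f ^ (p - 1) ∉ frobPower p P 1 := by
  classical
  intro hP
  have hfP : f ∈ P := Ideal.IsPrime.mem_of_pow_mem ‹_› _ (frobPower_one_le p P hP)
  rw [B.mem_frobPower_iff] at hP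
  let s := (B.coord (f ^ (p - 1))).support
  obtain ⟨ψ, hψ, t, ht, hdvd⟩ := B.exists_isCartierLinear_of_isFPure h
    (insert (1, 1) (s.image fun i => (f * B.vec i, 0))) (by
      simp only [Finset.mem_insert, Finset.mem_image]
      rintro _ (rfl | ⟨i, -, rfl⟩)
      · simp
      · simp [QuotLoc.algebraMap_self, hp.out.ne_zero])
  have hvec (i : ι) (hi : i ∈ s) : f ∣ ψ (f * B.vec i) := by
    simpa using hdvd _ (Finset.mem_insert_of_mem (Finset.mem_image_of_mem _ hi))
  choose! β hβ using hvec
  have hfψ : f * ψ 1 = f * ∑ i ∈ s, B.coordAt i (f ^ (p - 1)) * β i := by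
    calc f * ψ 1 = ψ (f * f ^ (p - 1)) := by rw [mul_pow_sub_one hp.out.ne_zero, ← hψ, mul_one]
      _ = ψ (∑ i ∈ s, B.coordAt i (f ^ (p - 1)) ^ p * (f * B.vec i)) := by
          conv_lhs => rw [← B.sum_coordAt (subset_refl s), Finset.mul_sum]
          simp only [mul_left_comm f]
      _ = ∑ i ∈ s, B.coordAt i (f ^ (p - 1)) * (f * β i) := by
          rw [map_sum]
          exact Finset.sum_congr rfl fun i hi => by rw [hψ, hβ i hi]
      _ = _ := by simp only [Finset.mul_sum, mul_left_comm f]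
  have hψP : ψ 1 ∈ P := by
    rw [(mul_cancel_left_mem_nonZeroDivisors hf).mp hfψ]
    exact P.sum_mem fun i _ => P.mul_mem_right _ (hP i)
  have h1 : f ∣ ψ 1 - t := by simpa using hdvd _ (Finset.mem_insert_self _ _)
  exact ht ((P.sub_mem_iff_right hψP).mp (P.mem_of_dvd h1 hfP))

lemma isFPure_quotLoc_iff [CharP R p] (hf : f ∈ nonZeroDivisors R) :
    IsFPure p (QuotLoc f P) ↔ f ^ (p - 1) ∉ frobPower p P 1 :=
  ⟨B.notMem_frobPower_of_isFPure hf, B.isFPure_quotLoc⟩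

end FrobeniusDualBasis

end Fedder

section HomogeneousColon

open DirectSum

lemma isHomogeneous_colon {ι σ A : Type*} [CommRing A] [SetLike σ A] [AddSubmonoidClass σ A]
    [DecidableEq ι] [AddRightCancelMonoid ι] {𝒜 : ι → σ} [GradedRing 𝒜] {I J : Ideal A}
    (hI : I.IsHomogeneous 𝒜) (hJ : J.IsHomogeneous 𝒜) : (I.colon (J : Set A)).IsHomogeneous 𝒜 := by
  classical
  intro i r hr
  refine Submodule.mem_colon.mpr fun x hx => ?_
  rw [smul_eq_mul, ← sum_support_decompose 𝒜 x, Finset.mul_sum]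
  refine Ideal.sum_mem _ fun j _ => ?_
  rw [← coe_decompose_mul_add_of_right_mem 𝒜 (SetLike.coe_mem (decompose 𝒜 x j)) (a := r)]
  exact hI _ (Submodule.mem_colon.mp hr _ (hJ j hx))

end HomogeneousColon

section TestIdeal

open MvPolynomial

lemma FrobeniusDualBasis.mem_frobPower_colon_iff {R ι : Type*} [CommRing R] {p : ℕ}
    (B : FrobeniusDualBasis p R ι) {J : Ideal R} {b g : R} :
    b ∈ frobPower p (J.colon {g}) 1 ↔ b * g ^ p ∈ frobPower p J 1 := by
  simp only [B.mem_frobPower_iff, (B.isCartierLinear_coordAt _).map_mul_pow,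
    Submodule.mem_colon_singleton, smul_eq_mul, mul_comm g]

variable {k : Type u} [Field k] {n p : ℕ} [hp : Fact p.Prime] [CharP k p]
  {f : Poly k n} {J : Ideal (Poly k n)}

lemma testIdeal_le_iff : testIdeal p f 1 ≤ J ↔ f ^ (p - 1) ∈ frobPower p J 1 := by
  obtain ⟨ι, ⟨B⟩⟩ := FrobeniusDualBasis.exists_of_field k p
  have mem_frobPower_testIdeal : f ^ (p - 1) ∈ frobPower p (testIdeal p f 1) 1 := by
    refine (B.mvPolynomial.mem_frobPower_iff).mpr fun i => Ideal.mem_sInf.mpr fun {𝔞} h𝔞 => ?_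
    rw [Set.mem_ofPred, pow_one] at h𝔞
    exact (B.mvPolynomial.isCartierLinear_coordAt i).mem_of_mem_frobPower h𝔞
  refine ⟨fun h => frobPower_mono p h 1 mem_frobPower_testIdeal, fun h => sInf_le ?_⟩
  rwa [Set.mem_ofPred, pow_one]

lemma FrobeniusDualBasis.testIdeal_eq_span {ι : Type*} (B : FrobeniusDualBasis p (Poly k n) ι) :
    testIdeal p f 1 = Ideal.span (Set.range fun i => B.coordAt i (f ^ (p - 1))) :=
  eq_of_forall_ge_iff fun J => by
    rw [testIdeal_le_iff, B.mem_frobPower_iff, Ideal.span_le, Set.range_subset_iff]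
    rfl

lemma pow_mul_pow_mem_frobPower_iff {g : Poly k n} :
    f ^ (p - 1) * g ^ p ∈ frobPower p J 1 ↔ g ∈ J.colon (testIdeal p f 1 : Set (Poly k n)) := by
  obtain ⟨ι, ⟨B⟩⟩ := FrobeniusDualBasis.exists_of_field k p
  rw [← B.mvPolynomial.mem_frobPower_colon_iff, ← testIdeal_le_iff]
  simp only [SetLike.le_def, Submodule.mem_colon, Set.mem_singleton_iff, forall_eq,
    SetLike.mem_coe, smul_eq_mul, mul_comm g]

lemma self_mem_testIdeal : f ∈ testIdeal p f 1 := by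
  obtain ⟨ι, ⟨B⟩⟩ := FrobeniusDualBasis.exists_of_field k p
  have h : 1 * f ^ p ∈ frobPower p (testIdeal p f 1) 1 := by
    rw [one_mul, ← pow_sub_one_mul hp.out.ne_zero]
    exact Ideal.mul_mem_right _ _ (testIdeal_le_iff.mp le_rfl)
  have := frobPower_one_le p _ (B.mvPolynomial.mem_frobPower_colon_iff.mpr h)
  rwa [Submodule.mem_colon_singleton, one_smul] at this

attribute [local instance] MvPolynomial.gradedAlgebra in
lemma isHomogeneous_testIdeal {d : ℕ} (hf : f.IsHomogeneous d) :
    (testIdeal p f 1).IsHomogeneous (homogeneousSubmodule (Fin (n + 1)) k) := by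
  obtain ⟨ι, ⟨B⟩⟩ := FrobeniusDualBasis.exists_of_field k p
  rw [B.mvPolynomial.testIdeal_eq_span]
  refine Ideal.homogeneous_span _ _ ?_
  rintro _ ⟨i, rfl⟩
  exact ⟨_, B.isHomogeneous_coordAt (hf.pow (p - 1)) i⟩

section Purity

variable {P : Ideal (Poly k n)} [P.IsPrime]

lemma isFPure_hypLoc_iff (hf : f ≠ 0) : IsFPure p (HypLoc f P) ↔ ¬ testIdeal p f 1 ≤ P := by
  obtain ⟨ι, ⟨B⟩⟩ := FrobeniusDualBasis.exists_of_field k p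
  rw [testIdeal_le_iff]
  exact B.mvPolynomial.isFPure_quotLoc_iff (mem_nonZeroDivisors_of_ne_zero hf)

lemma isFPure_hypLoc_zero : IsFPure p (HypLoc (0 : Poly k n) P) := by
  obtain ⟨ι, ⟨B⟩⟩ := FrobeniusDualBasis.exists_of_field k p
  exact B.mvPolynomial.isFPure_quotLoc_zero

lemma IsolatedNonFPure.ne_zero (h : IsolatedNonFPure p f) : f ≠ 0 := by
  rintro rfl
  exact h.1 isFPure_hypLoc_zero

lemma isolatedNonFPure_iff (hf : f ≠ 0) : IsolatedNonFPure p f ↔ testIdeal p f 1 ≤ maxIdeal k n ∧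
    ∀ (P : Ideal (Poly k n)) [P.IsPrime], P < maxIdeal k n → ¬ testIdeal p f 1 ≤ P := by
  simp only [IsolatedNonFPure, isFPure_hypLoc_iff hf, not_not]

end Purity

lemma ne_zero_of_testIdeal_eq {j : ℕ} (h : testIdeal p f 1 = maxIdeal k n ^ j) : f ≠ 0 := by
  rintro rfl
  have hbot : testIdeal p (0 : Poly k n) 1 = ⊥ := by
    rw [eq_bot_iff, testIdeal_le_iff, zero_pow (Nat.sub_pos_of_lt hp.out.one_lt).ne']
    exact Ideal.zero_mem _
  have hX : (X 0 : Poly k n) ^ j ∈ maxIdeal k n ^ j :=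
    Ideal.pow_mem_pow (Ideal.subset_span (Set.mem_range_self 0)) j
  rw [← h, hbot, Ideal.mem_bot] at hX
  exact pow_ne_zero j (X_ne_zero 0) hX

lemma isolatedNonFPure_of_testIdeal_eq {j : ℕ} (hj : 1 ≤ j)
    (h : testIdeal p f 1 = maxIdeal k n ^ j) : IsolatedNonFPure p f := by
  rw [isolatedNonFPure_iff (ne_zero_of_testIdeal_eq h), h]
  exact ⟨Ideal.pow_le_self (Nat.one_le_iff_ne_zero.mp hj),
    fun P _ hP hle => hP.not_ge (Ideal.IsPrime.le_of_pow_le hle)⟩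

end TestIdeal

section SocleDegrees

open MvPolynomial

variable {k : Type u} [Field k] {n p : ℕ}

lemma mem_maxIdeal_iff {g : Poly k n} : g ∈ maxIdeal k n ↔ coeff 0 g = 0 := by
  change g ∈ idealOfVars _ _ ↔ _
  rw [← pow_one (idealOfVars _ _), mem_pow_idealOfVars_iff']
  simp [Finsupp.degree_eq_zero_iff]

attribute [local instance] MvPolynomial.gradedAlgebra in
lemma le_maxIdeal_of_isHomogeneous {I : Ideal (Poly k n)}
    (hI : I.IsHomogeneous (homogeneousSubmodule (Fin (n + 1)) k)) (hI' : I ≠ ⊤) :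
    I ≤ maxIdeal k n := by
  intro g hg
  rw [mem_maxIdeal_iff]
  by_contra h0
  have hC := homogeneousComponent_mem_of_mem hI hg 0
  rw [homogeneousComponent_zero] at hC
  exact hI' (Ideal.eq_top_of_isUnit_mem _ hC ((isUnit_iff_ne_zero.mpr h0).map C))

attribute [local instance] MvPolynomial.gradedAlgebra in
lemma exists_maxIdeal_pow_le {τ : Ideal (Poly k n)}
    (hτ : τ.IsHomogeneous (homogeneousSubmodule (Fin (n + 1)) k))
    (hP : ∀ (P : Ideal (Poly k n)) [P.IsPrime], P < maxIdeal k n → ¬ τ ≤ P) :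
    ∃ N : ℕ, maxIdeal k n ^ N ≤ τ := by
  refine Ideal.exists_pow_le_of_le_radical_of_fg ?_ (IsNoetherian.noetherian _)
  rw [Ideal.radical_eq_sInf]
  refine le_sInf ?_
  rintro P ⟨hτP, hPp⟩
  let Q := P.homogeneousCore (homogeneousSubmodule (Fin (n + 1)) k)
  have hQp : Q.toIdeal.IsPrime := hPp.homogeneousCore
  have hτQ : τ ≤ Q.toIdeal := by
    rw [← hτ.toIdeal_homogeneousCore_eq_self]
    exact Ideal.homogeneousCore_mono _ hτP
  have hQ : Q.toIdeal = maxIdeal k n :=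
    (le_maxIdeal_of_isHomogeneous Q.isHomogeneous hQp.ne_top).eq_of_not_lt fun h => hP _ h hτQ
  rw [← hQ]
  exact Ideal.toIdeal_homogeneousCore_le _ P

/-- The exponent vector of `(x₀ ⋯ xₙ) ^ t`. -/
def constExp (n t : ℕ) : Fin (n + 1) →₀ ℕ := Finsupp.equivFunOnFinite.symm fun _ => t

@[simp]
lemma constExp_apply (t : ℕ) (i : Fin (n + 1)) : constExp n t i = t := rfl

lemma degree_constExp (t : ℕ) : (constExp n t).degree = (n + 1) * t := by
  simp [Finsupp.degree_eq_sum]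

section FrobPower

variable [hp : Fact p.Prime] [CharP k p] {e : ℕ} {g : Poly k n}

lemma frobPower_maxIdeal : frobPower p (maxIdeal k n) e =
    Ideal.span ((fun a => monomial a (1 : k)) '' Set.range fun i => Finsupp.single i (p ^ e)) := by
  rw [maxIdeal, frobPower_span, ← Set.range_comp, ← Set.range_comp]
  simp only [Function.comp_def, X_pow_eq_monomial]

lemma mem_frobPower_maxIdeal_iff :
    g ∈ frobPower p (maxIdeal k n) e ↔ ∀ a ∈ g.support, ∃ i, p ^ e ≤ a i := by
  simp [frobPower_maxIdeal, mem_ideal_span_monomial_image]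

lemma notMem_frobPower_maxIdeal_iff :
    g ∉ frobPower p (maxIdeal k n) e ↔ ∃ a ∈ g.support, a ≤ constExp n (p ^ e - 1) := by
  have hpos : 0 < p ^ e := pow_pos hp.out.pos e
  simp only [mem_frobPower_maxIdeal_iff, not_forall, not_exists, not_le, exists_prop,
    Finsupp.le_def, constExp_apply, Nat.le_sub_one_iff_lt hpos]

attribute [local instance] MvPolynomial.gradedAlgebra in
lemma isHomogeneous_frobPower_maxIdeal : (frobPower p (maxIdeal k n) e).IsHomogeneous
    (homogeneousSubmodule (Fin (n + 1)) k) := by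
  rw [frobPower_maxIdeal]
  refine Ideal.homogeneous_span _ _ ?_
  rintro _ ⟨a, -, rfl⟩
  exact ⟨_, isHomogeneous_monomial _ rfl⟩

lemma mul_monomial_constExp_mem_frobPower_iff {e' t : ℕ} (h : p ^ e' = p ^ e + t) :
    g * monomial (constExp n t) 1 ∈ frobPower p (maxIdeal k n) e' ↔
      g ∈ frobPower p (maxIdeal k n) e := by
  have hpos : 0 < p ^ e := pow_pos hp.out.pos e
  have hle (a : Fin (n + 1) →₀ ℕ) :
      a + constExp n t ≤ constExp n (p ^ e' - 1) ↔ a ≤ constExp n (p ^ e - 1) := by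
    simp only [Finsupp.le_def, Finsupp.add_apply, constExp_apply]
    exact forall_congr' fun i => by omega
  have hsupp : (g * monomial (constExp n t) 1).support = g.support.map (addRightEmbedding _) :=
    AddMonoidAlgebra.support_coeff_mul_single g 1 (by simp) _
  rw [← not_iff_not, notMem_frobPower_maxIdeal_iff, notMem_frobPower_maxIdeal_iff, hsupp]
  simp [hle]

lemma monomial_mem_colon_maxIdeal_pow {a : Fin (n + 1) →₀ ℕ} {j : ℕ}
    (h : (n + 1) * (p ^ e - 1) < a.degree + j) : monomial a (1 : k) ∈
      (frobPower p (maxIdeal k n) e).colon ((maxIdeal k n ^ j : Ideal (Poly k n)) : Set _) := by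
  refine Submodule.mem_colon.mpr fun c hc => ?_
  rw [smul_eq_mul, mul_comm]
  by_contra hmem
  obtain ⟨b, hb, hle⟩ := notMem_frobPower_maxIdeal_iff.mp hmem
  rw [mem_support_iff, coeff_mul_monomial', mul_one, ite_ne_right_iff] at hb
  have hdeg : j ≤ (b - a).degree :=
    (mem_pow_idealOfVars_iff j c).mp hc _ (mem_support_iff.mpr hb.2)
  have hsum : (b - a).degree + a.degree = b.degree := by
    rw [← map_add, tsub_add_cancel_of_le hb.1]
  have hmono : b.degree ≤ (n + 1) * (p ^ e - 1) := by
    rw [← degree_constExp]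
    exact Finsupp.degree_mono hle
  omega

end FrobPower

/-- The degrees of the homogeneous elements of `(𝔪^{[p^e]} : τ) \ 𝔪^{[p^e]}`. -/
def colonDegrees (p : ℕ) (τ : Ideal (Poly k n)) (e : ℕ) : Set ℕ :=
  {s | ∃ g : Poly k n, g.IsHomogeneous s ∧
    g ∈ (frobPower p (maxIdeal k n) e).colon (τ : Set (Poly k n)) ∧
    g ∉ frobPower p (maxIdeal k n) e}

/-- The degrees of the nonzero homogeneous elements of the annihilator of `τ` in `H^{n+1}_𝔪(R)`.
These elements are represented by the fractions `g / (x₀ ⋯ xₙ) ^ p ^ e` with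
`g ∈ (𝔪^{[p^e]} : τ) \ 𝔪^{[p^e]}`. -/
def annDegrees (p : ℕ) (τ : Ideal (Poly k n)) : Set ℤ :=
  {z | ∃ e, ∃ s ∈ colonDegrees p τ e, (s : ℤ) - (n + 1) * p ^ e = z}

lemma minDeg_eq_iff {f : Poly k n} {e M : ℕ} :
    minDeg p f e = M ↔ IsLeast (colonDegrees p (testIdeal p f 1) e) M := by
  have h : minDeg p f e = sInf ((↑) '' colonDegrees p (testIdeal p f 1) e) := by
    refine congrArg sInf (Set.ext fun r => ⟨?_, ?_⟩)
    · rintro ⟨s, g, h1, h2, h3, rfl⟩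
      exact ⟨s, ⟨g, h1, h2, h3⟩, rfl⟩
    · rintro ⟨s, ⟨g, h1, h2, h3⟩, rfl⟩
      exact ⟨s, g, h1, h2, h3, rfl⟩
  rw [h]
  have hmono : Monotone ((↑) : ℕ → ℕ∞) := Nat.mono_cast
  refine ⟨fun hM => ?_, fun hM => (hmono.map_isLeast hM).csInf_eq⟩
  have hne : ((↑) '' colonDegrees p (testIdeal p f 1) e : Set ℕ∞).Nonempty := by
    refine Set.nonempty_iff_ne_empty.mpr fun h0 => ?_
    rw [h0, sInf_empty] at hM
    exact ENat.top_ne_natCast M hM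
  obtain ⟨s, hs, hsM⟩ := hM ▸ csInf_mem hne
  obtain rfl : s = M := by exact_mod_cast hsM
  refine ⟨hs, fun t ht => ?_⟩
  have : (s : ℕ∞) ≤ t := hM ▸ sInf_le ⟨t, ht, rfl⟩
  exact_mod_cast this

variable [hp : Fact p.Prime] [CharP k p] {τ : Ideal (Poly k n)}

lemma add_mem_colonDegrees {e e' s : ℕ} (hs : s ∈ colonDegrees p τ e) (he : e ≤ e') :
    s + (n + 1) * (p ^ e' - p ^ e) ∈ colonDegrees p τ e' := by
  obtain ⟨g, hg, hcolon, hmem⟩ := hs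
  have hpow : p ^ e' = p ^ e + (p ^ e' - p ^ e) :=
    (Nat.add_sub_cancel' (Nat.pow_le_pow_right hp.out.pos he)).symm
  refine ⟨g * monomial (constExp n (p ^ e' - p ^ e)) 1,
    hg.mul (isHomogeneous_monomial _ (degree_constExp _)), ?_, ?_⟩
  · refine Submodule.mem_colon.mpr fun c hc => ?_
    rw [smul_eq_mul, mul_right_comm, mul_monomial_constExp_mem_frobPower_iff hpow]
    exact Submodule.mem_colon.mp hcolon c hc
  · rwa [mul_monomial_constExp_mem_frobPower_iff hpow]

lemma eventually_exists_colonDegrees {z : ℤ} (hz : z ∈ annDegrees p τ) :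
    ∀ᶠ e in Filter.atTop, ∃ s ∈ colonDegrees p τ e, (s : ℤ) - (n + 1) * p ^ e = z := by
  obtain ⟨e₀, s, hs, rfl⟩ := hz
  filter_upwards [Filter.eventually_ge_atTop e₀] with e he
  refine ⟨_, add_mem_colonDegrees hs he, ?_⟩
  push_cast [Nat.pow_le_pow_right hp.out.pos he]
  ring

lemma isDelta_iff_isLeast {f : Poly k n} {δ : ℤ} :
    IsDelta p f δ ↔ IsLeast (annDegrees p (testIdeal p f 1)) δ := by
  simp only [IsDelta, minDeg_eq_iff]
  refine ⟨fun h => ⟨?_, fun z hz => ?_⟩, fun h => ?_⟩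
  · obtain ⟨e, M, hM, hδ⟩ := h.exists
    exact ⟨e, M, hM.1, hδ⟩
  · obtain ⟨e, ⟨M, hM, hδ⟩, s, hs, hz⟩ := (h.and (eventually_exists_colonDegrees hz)).exists
    have : M ≤ s := hM.2 hs
    lia
  · filter_upwards [eventually_exists_colonDegrees h.1] with e ⟨s, hs, hδ⟩
    refine ⟨s, ⟨hs, fun t ht => ?_⟩, hδ⟩
    have := h.2 ⟨e, t, ht, rfl⟩
    lia

lemma neg_sub_le_of_mem_annDegrees {N : ℕ} {z : ℤ} (hN : maxIdeal k n ^ N ≤ τ)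
    (hz : z ∈ annDegrees p τ) : -(n : ℤ) - N ≤ z := by
  obtain ⟨e, s, ⟨g, hg, hcolon, hmem⟩, rfl⟩ := hz
  obtain ⟨a, ha, hle⟩ := notMem_frobPower_maxIdeal_iff.mp hmem
  let b := constExp n (p ^ e - 1) - a
  have hab : a + b = constExp n (p ^ e - 1) := add_tsub_cancel_of_le hle
  have hb : b.degree < N := by
    by_contra! hb
    have hbτ : monomial b (1 : k) ∈ τ :=
      hN ((monomial_mem_pow_idealOfVars_iff N b one_ne_zero).mpr hb)
    refine notMem_frobPower_maxIdeal_iff.mpr ⟨a + b, ?_, hab.le⟩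
      (Submodule.mem_colon.mp hcolon _ hbτ)
    rwa [smul_eq_mul, mem_support_iff, coeff_mul_monomial, mul_one, ← mem_support_iff]
  have hdeg : a.degree + b.degree = (n + 1) * (p ^ e - 1) := by
    rw [← map_add, hab, degree_constExp]
  have hs : a.degree = s := (hg.degree_eq_sum_deg_support ha).symm
  have hpos : 1 ≤ p ^ e := Nat.one_le_pow _ _ hp.out.pos
  zify [hpos] at hdeg hs hb
  linarith

attribute [local instance] MvPolynomial.gradedAlgebra in
lemma exists_support_degree_sub_mem_annDegrees {e : ℕ} {g : Poly k n}
    (hτ : τ.IsHomogeneous (homogeneousSubmodule (Fin (n + 1)) k))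
    (hcolon : g ∈ (frobPower p (maxIdeal k n) e).colon (τ : Set (Poly k n)))
    (hg : g ∉ frobPower p (maxIdeal k n) e) :
    ∃ a ∈ g.support, (a.degree : ℤ) - (n + 1) * p ^ e ∈ annDegrees p τ := by
  obtain ⟨a, ha, hle⟩ := notMem_frobPower_maxIdeal_iff.mp hg
  have hmem := homogeneousComponent_mem_of_mem
    (isHomogeneous_colon isHomogeneous_frobPower_maxIdeal hτ) hcolon a.degree
  refine ⟨a, ha, e, a.degree, ⟨_, homogeneousComponent_isHomogeneous _ g, hmem,
    notMem_frobPower_maxIdeal_iff.mpr ⟨a, ?_, hle⟩⟩, rfl⟩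
  rwa [mem_support_iff, coeff_homogeneousComponent, if_pos rfl, ← mem_support_iff]

omit hp [CharP k p] in
lemma zero_mem_colonDegrees (h : τ ≤ maxIdeal k n) : 0 ∈ colonDegrees p τ 0 := by
  refine ⟨1, isHomogeneous_one _ _, Submodule.mem_colon.mpr fun c hc => ?_, ?_⟩
  · rw [frobPower_zero, one_smul]
    exact h hc
  · rw [frobPower_zero]
    exact (maxIdeal k n).one_notMem

lemma exists_isLeast_annDegrees {N : ℕ} (hN : maxIdeal k n ^ N ≤ τ) (hτ : τ ≤ maxIdeal k n) :
    ∃ δ, IsLeast (annDegrees p τ) δ := by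
  obtain ⟨δ, hδ, hmin⟩ := Int.exists_least_of_bdd
    ⟨-(n : ℤ) - N, fun z hz => neg_sub_le_of_mem_annDegrees hN hz⟩
    ⟨_, 0, 0, zero_mem_colonDegrees hτ, rfl⟩
  exact ⟨δ, hδ, hmin⟩

lemma isLeast_annDegrees_maxIdeal_pow {j : ℕ} (hj : 1 ≤ j) :
    IsLeast (annDegrees p (maxIdeal k n ^ j)) (-n - j) := by
  refine ⟨?_, fun z hz => neg_sub_le_of_mem_annDegrees le_rfl hz⟩
  have hjp : j ≤ p ^ j := (Nat.lt_pow_self hp.out.one_lt).le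
  let a := constExp n (p ^ j - 1) - Finsupp.single 0 (j - 1)
  have ha : a ≤ constExp n (p ^ j - 1) := tsub_le_self
  have hdeg : a.degree + (j - 1) = (n + 1) * (p ^ j - 1) := by
    rw [← degree_constExp, ← Finsupp.degree_single (0 : Fin (n + 1)) (j - 1), ← map_add,
      tsub_add_cancel_of_le (Finsupp.single_le_iff.mpr (by rw [constExp_apply]; omega))]
  refine ⟨j, a.degree, ⟨monomial a 1, isHomogeneous_monomial _ rfl,
    monomial_mem_colon_maxIdeal_pow (by omega),
    notMem_frobPower_maxIdeal_iff.mpr ⟨a, by simp, ha⟩⟩, ?_⟩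
  zify [hj, hj.trans hjp] at hdeg
  linarith

lemma IsolatedNonFPure.exists_isDelta {f : Poly k n} {d : ℕ} (h : IsolatedNonFPure p f)
    (hf : f.IsHomogeneous d) : ∃ δ, IsDelta p f δ := by
  obtain ⟨hle, hP⟩ := (isolatedNonFPure_iff h.ne_zero).mp h
  obtain ⟨N, hN⟩ := exists_maxIdeal_pow_le (isHomogeneous_testIdeal hf) hP
  simpa only [isDelta_iff_isLeast] using exists_isLeast_annDegrees hN hle

end SocleDegrees

section Alternating

variable {ι V : Type*} [LinearOrder ι] [AddCommGroup V]

/-- The sign of `j` in the alternating differential at `J`: `-1` to the power of the position of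
`j` in `J`. -/
def posSign (j : ι) (J : Finset ι) : ℤ := (-1) ^ (J.filter (· < j)).card

lemma posSign_mul_self (j : ι) (J : Finset ι) : posSign j J * posSign j J = 1 := by
  rw [posSign, ← mul_pow, neg_one_mul, neg_neg, one_pow]

lemma posSign_insert_of_lt {i j : ι} {J : Finset ι} (hi : i ∉ J) (h : i < j) :
    posSign j (insert i J) = -posSign j J := by
  rw [posSign, Finset.filter_insert, if_pos h, Finset.card_insert_of_notMem (by simp [hi]),
    pow_succ, mul_neg_one, posSign]

lemma posSign_insert_of_le {i j : ι} (J : Finset ι) (h : j ≤ i) :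
    posSign j (insert i J) = posSign j J := by
  rw [posSign, Finset.filter_insert, if_neg h.not_gt, posSign]

lemma posSign_erase_of_lt {i j : ι} {J : Finset ι} (hi : i ∈ J) (h : i < j) :
    posSign j (J.erase i) = -posSign j J := by
  rw [← neg_eq_iff_eq_neg, ← posSign_insert_of_lt (Finset.notMem_erase i J) h,
    Finset.insert_erase hi]

lemma posSign_erase_of_le {i j : ι} (J : Finset ι) (h : j ≤ i) :
    posSign j (J.erase i) = posSign j J := by
  rw [posSign, Finset.filter_erase, Finset.erase_eq_of_notMem (by simp [h]), posSign]

lemma posSign_mul_posSign_erase {i j : ι} {J : Finset ι} (hij : i ≠ j) (hi : i ∈ J) (hj : j ∈ J) :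
    posSign j J * posSign i (J.erase j) = -(posSign i J * posSign j (J.erase i)) := by
  rcases hij.lt_or_gt with h | h
  · rw [posSign_erase_of_lt hi h, posSign_erase_of_le J h.le]; ring
  · rw [posSign_erase_of_lt hj h, posSign_erase_of_le J h.le]; ring

lemma posSign_mul_posSign_insert {i j : ι} {J : Finset ι} (hi : i ∉ J) (hj : j ∈ J) :
    posSign j J * posSign i (J.erase j) = -(posSign i J * posSign j (insert i J)) := by
  rcases (ne_of_mem_of_not_mem hj hi).symm.lt_or_gt with h | h
  · rw [posSign_insert_of_lt hi h, posSign_erase_of_le J h.le]; ring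
  · rw [posSign_erase_of_lt hj h, posSign_insert_of_le J h.le]; ring

/-- The alternating differential, on families indexed by all finite subsets; the Čech
differential is its restriction to families concentrated on the subsets of a given size. -/
def altDiff : (Finset ι → V) →+ (Finset ι → V) where
  toFun γ J := ∑ j ∈ J, posSign j J • γ (J.erase j)
  map_zero' := by funext J; simp
  map_add' γ γ' := by funext J; simp [Finset.sum_add_distrib]

lemma altDiff_apply (γ : Finset ι → V) (J : Finset ι) :
    altDiff γ J = ∑ j ∈ J, posSign j J • γ (J.erase j) := rfl

lemma altDiff_altDiff (γ : Finset ι → V) : altDiff (altDiff γ) = 0 := by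
  funext J
  simp only [altDiff_apply, Finset.smul_sum, smul_smul, Pi.zero_apply]
  rw [Finset.sum_sigma']
  refine Finset.sum_involution (fun x _ => ⟨x.2, x.1⟩) ?_ ?_ ?_ fun _ _ => rfl <;>
    rintro ⟨j, i⟩ h <;> obtain ⟨hj, hij, hi⟩ : j ∈ J ∧ i ≠ j ∧ i ∈ J := by simpa using h
  · rw [posSign_mul_posSign_erase hij hi hj, Finset.erase_right_comm, neg_smul, neg_add_cancel]
  · exact fun _ heq => hij (congrArg Sigma.fst heq)
  · simpa using ⟨hi, hij.symm, hj⟩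

lemma map_altDiff {W : Type*} [AddCommGroup W] (φ : V →+ W) (γ : Finset ι → V) (J : Finset ι) :
    φ (altDiff γ J) = altDiff (fun I => φ (γ I)) J := by
  simp only [altDiff_apply, map_sum, map_zsmul]

lemma altDiff_smul {R : Type*} [DistribSMul R V] (a : R) (γ : Finset ι → V) :
    altDiff (a • γ) = a • altDiff γ :=
  funext fun J => (map_altDiff (DistribSMul.toAddMonoidHom V a) γ J).symm

/-- Contraction with `i`, a null-homotopy of the alternating complex. -/
def contract (i : ι) (γ : Finset ι → V) (J : Finset ι) : V :=
  if i ∈ J then 0 else posSign i J • γ (insert i J)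

lemma contract_of_mem {i : ι} (γ : Finset ι → V) {J : Finset ι} (hi : i ∈ J) :
    contract i γ J = 0 := if_pos hi

lemma contract_of_notMem {i : ι} (γ : Finset ι → V) {J : Finset ι} (hi : i ∉ J) :
    contract i γ J = posSign i J • γ (insert i J) := if_neg hi

lemma altDiff_contract_of_mem {i : ι} (γ : Finset ι → V) {J : Finset ι} (hi : i ∈ J) :
    altDiff (contract i γ) J = γ J := by
  rw [altDiff_apply, Finset.sum_eq_single_of_mem i hi]
  · rw [contract_of_notMem γ (Finset.notMem_erase i J), Finset.insert_erase hi, smul_smul,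
      posSign_erase_of_le J le_rfl, posSign_mul_self, one_smul]
  · intro j _ hji
    rw [contract_of_mem γ (Finset.mem_erase.mpr ⟨hji.symm, hi⟩), smul_zero]

lemma altDiff_contract_of_notMem {i : ι} (γ : Finset ι → V) {J : Finset ι} (hi : i ∉ J) :
    altDiff (contract i γ) J = γ J - posSign i J • altDiff γ (insert i J) := by
  have hterm (j) (hj : j ∈ J) : posSign j J • contract i γ (J.erase j) =
      -(posSign i J • posSign j (insert i J) • γ ((insert i J).erase j)) := by
    have hij : i ≠ j := (ne_of_mem_of_not_mem hj hi).symm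
    rw [contract_of_notMem γ fun h => hi (Finset.mem_of_mem_erase h), smul_smul, smul_smul,
      posSign_mul_posSign_insert hi hj, neg_smul, Finset.erase_insert_of_ne hij]
  rw [altDiff_apply, altDiff_apply, Finset.sum_insert hi, Finset.erase_insert hi, smul_add,
    smul_smul, posSign_insert_of_le J le_rfl, posSign_mul_self, one_smul,
    Finset.sum_congr rfl hterm, Finset.sum_neg_distrib, Finset.smul_sum, sub_add_cancel_left]

lemma altDiff_contract {i : ι} {γ : Finset ι → V} (hγ : altDiff γ = 0) :
    altDiff (contract i γ) = γ := by
  funext J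
  by_cases hi : i ∈ J
  · exact altDiff_contract_of_mem γ hi
  · rw [altDiff_contract_of_notMem γ hi, hγ, Pi.zero_apply, smul_zero, sub_zero]

end Alternating

section Support

open AddMonoidAlgebra

variable {k G : Type*} [CommRing k] {S T U : Set G}

lemma eq_zero_of_mem_supported_empty {l : AddMonoidAlgebra k G} (h : l ∈ supported k k ∅) :
    l = 0 := by
  ext z
  exact mem_supported'.mp h z (Set.notMem_empty z)

lemma mul_mem_supported [Add G] {l l' : AddMonoidAlgebra k G} (h : l ∈ supported k k S)
    (h' : l' ∈ supported k k T) (hST : ∀ z ∈ S, ∀ w ∈ T, z + w ∈ U) :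
    l * l' ∈ supported k k U := by
  classical
  intro v hv
  obtain ⟨z, hz, w, hw, rfl⟩ := Finset.mem_add.mp (support_coeff_mul_subset l l' hv)
  exact hST z (h hz) w (h' hw)

open Classical in
/-- The part of an element of a monoid algebra supported in `S`. -/
def truncate (S : Set G) : AddMonoidAlgebra k G →+ AddMonoidAlgebra k G where
  toFun l := ofCoeff (l.coeff.filter (· ∈ S))
  map_zero' := by ext; simp [Finsupp.filter_apply]
  map_add' l l' := by ext z; simp [Finsupp.filter_apply, ite_add_ite]

open Classical in
lemma coeff_truncate (S : Set G) (l : AddMonoidAlgebra k G) (z : G) :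
    (truncate S l).coeff z = if z ∈ S then l.coeff z else 0 := Finsupp.filter_apply _ _ _

lemma truncate_mem (S : Set G) (l : AddMonoidAlgebra k G) : truncate S l ∈ supported k k S :=
  mem_supported'.mpr fun z hz => by rw [coeff_truncate, if_neg hz]

lemma truncate_mem_of_mem (S : Set G) {l : AddMonoidAlgebra k G} (h : l ∈ supported k k T) :
    truncate S l ∈ supported k k T :=
  mem_supported'.mpr fun z hz => by rw [coeff_truncate, mem_supported'.mp h z hz, ite_self]

lemma sub_truncate_mem (S : Set G) {l : AddMonoidAlgebra k G} (h : l ∈ supported k k T) :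
    l - truncate S l ∈ supported k k (T \ S) := by
  refine mem_supported'.mpr fun z hz => ?_
  rw [coeff_sub, Finsupp.sub_apply, coeff_truncate]
  split_ifs with hS
  · rw [sub_self]
  · rw [sub_zero, mem_supported'.mp h z fun hT => hz ⟨hT, hS⟩]

lemma truncate_eq_self {l : AddMonoidAlgebra k G} (h : l ∈ supported k k S) :
    truncate S l = l := by
  rw [eq_comm, ← sub_eq_zero]
  exact eq_zero_of_mem_supported_empty (by simpa using sub_truncate_mem S h)

lemma truncate_eq_zero {l : AddMonoidAlgebra k G} (h : l ∈ supported k k Sᶜ) :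
    truncate S l = 0 := by
  ext z
  rw [coeff_truncate]
  split_ifs with hz
  · exact mem_supported'.mp h z (Set.notMem_compl_iff.mpr hz)
  · rfl

lemma truncate_mul [Add G] {a l : AddMonoidAlgebra k G} (ha : a ∈ supported k k U)
    (hUS : ∀ z ∈ U, ∀ w, z + w ∈ S ↔ w ∈ T) : truncate S (a * l) = a * truncate T l := by
  have hmem : a * truncate T l ∈ supported k k S :=
    mul_mem_supported ha (truncate_mem T l) fun z hz w hw => (hUS z hz w).mpr hw
  have hrest : a * (l - truncate T l) ∈ supported k k Sᶜ := by
    refine mul_mem_supported ha (sub_truncate_mem T (T := Set.univ) (Set.subset_univ _))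
      fun z hz w hw h => hw.2 ((hUS z hz w).mp h)
  rw [← sub_eq_zero, ← truncate_eq_self hmem, ← map_sub, ← mul_sub, truncate_eq_zero hrest]

end Support

section Laurent

open AddMonoidAlgebra

variable {k σ : Type*} [CommRing k]

variable (k σ) in
/-- Laurent polynomials in the variables `σ`. The localizations of a polynomial ring at products of
variables are computed inside them. -/
abbrev Laurent : Type _ := AddMonoidAlgebra k (σ → ℤ)

/-- The exponents of the monomials of a polynomial, viewed as integers. -/
def exponent : (σ →₀ ℕ) →+ (σ → ℤ) where
  toFun a i := a i
  map_zero' := rfl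
  map_add' _ _ := funext fun _ => Nat.cast_add _ _

@[simp] lemma exponent_apply (a : σ →₀ ℕ) (i : σ) : exponent a i = a i := rfl

lemma exponent_injective : Function.Injective (exponent (σ := σ)) := fun _ _ h =>
  Finsupp.ext fun i => Nat.cast_injective (congrFun h i)

lemma sum_exponent [Fintype σ] (a : σ →₀ ℕ) : ∑ i, exponent a i = a.degree := by
  rw [Finsupp.degree_eq_sum, Nat.cast_sum]; rfl

lemma mem_range_exponent [Finite σ] {z : σ → ℤ} (hz : ∀ i, 0 ≤ z i) :
    z ∈ Set.range (exponent (σ := σ)) :=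
  ⟨Finsupp.equivFunOnFinite.symm fun i => (z i).toNat, funext fun i => Int.toNat_of_nonneg (hz i)⟩

/-- The inclusion of polynomials into Laurent polynomials. -/
def toLaurent : MvPolynomial σ k →+* Laurent k σ := mapDomainRingHom k exponent

lemma toLaurent_injective : Function.Injective (toLaurent (k := k) (σ := σ)) :=
  mapDomain_injective exponent_injective

lemma support_coeff_toLaurent (g : MvPolynomial σ k) :
    ((toLaurent g).coeff.support : Set (σ → ℤ)) = exponent '' g.support := by
  classical
  rw [← Finset.coe_image, Finset.coe_inj]
  exact Finsupp.mapDomain_support_of_injective exponent_injective _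

lemma exists_toLaurent_eq [Finite σ] {l : Laurent k σ}
    (h : l ∈ supported k k {z : σ → ℤ | ∀ i, 0 ≤ z i}) : ∃ g, toLaurent g = l :=
  ⟨_, mapDomain_comapDomain (fun _ hz => mem_range_exponent (h hz)) exponent_injective⟩

lemma toLaurent_mem_supported_sum [Fintype σ] {g : MvPolynomial σ k} {d : ℕ}
    (hg : g.IsHomogeneous d) : toLaurent g ∈ supported k k {z : σ → ℤ | ∑ i, z i = d} := by
  rw [mem_supported, support_coeff_toLaurent, Set.image_subset_iff]
  intro a ha
  rw [Set.mem_preimage, Set.mem_ofPred_eq, sum_exponent, hg.degree_eq_sum_deg_support ha]; rfl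

/-- The Laurent monomial with exponent `z`. -/
def laurentMonomial (z : σ → ℤ) : Laurent k σ := single z 1

lemma toLaurent_monomial (a : σ →₀ ℕ) :
    toLaurent (MvPolynomial.monomial a (1 : k)) = laurentMonomial (exponent a) :=
  mapDomain_single

lemma laurentMonomial_zero : laurentMonomial (0 : σ → ℤ) = (1 : Laurent k σ) := rfl

lemma laurentMonomial_mul (z w : σ → ℤ) :
    (laurentMonomial z * laurentMonomial w : Laurent k σ) = laurentMonomial (z + w) := by
  rw [laurentMonomial, laurentMonomial, single_mul_single, mul_one]; rfl

lemma laurentMonomial_pow (z : σ → ℤ) (N : ℕ) :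
    (laurentMonomial z ^ N : Laurent k σ) = laurentMonomial (N • z) := by
  rw [laurentMonomial, single_pow, one_pow]; rfl

lemma laurentMonomial_neg_mul (z : σ → ℤ) :
    (laurentMonomial (-z) * laurentMonomial z : Laurent k σ) = 1 := by
  rw [laurentMonomial_mul, neg_add_cancel, laurentMonomial_zero]

lemma isUnit_laurentMonomial (z : σ → ℤ) : IsUnit (laurentMonomial z : Laurent k σ) :=
  .of_mul_eq_one_right _ (laurentMonomial_neg_mul z)

lemma mul_laurentMonomial_mem_supported_iff {l : Laurent k σ} {w : σ → ℤ} {S : Set (σ → ℤ)} :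
    l * laurentMonomial w ∈ supported k k S ↔ l ∈ supported k k {z | z + w ∈ S} := by
  have hcoeff (z) : (l * laurentMonomial w).coeff (z + w) = l.coeff z := by
    rw [laurentMonomial, coeff_mul_single_apply, mul_one, add_neg_cancel_right]
  rw [mem_supported', mem_supported']
  refine ((Equiv.addRight w).forall_congr fun z => ?_).symm
  rw [Equiv.coe_addRight, hcoeff]; rfl

section Fraction

variable [DecidableEq σ]

/-- The exponent of the squarefree monomial `∏ i ∈ I, x_i`. -/
def indicatorExp (I : Finset σ) (i : σ) : ℤ := if i ∈ I then 1 else 0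

lemma toLaurent_prod_X (I : Finset σ) :
    toLaurent (∏ i ∈ I, (MvPolynomial.X i : MvPolynomial σ k)) =
      laurentMonomial (indicatorExp I) := by
  induction I using Finset.induction_on with
  | empty => rw [Finset.prod_empty, map_one]; rfl
  | insert i I hi ih =>
    rw [Finset.prod_insert hi, map_mul, ih, MvPolynomial.X, toLaurent_monomial, laurentMonomial_mul]
    congr 1
    funext j
    rcases eq_or_ne i j with rfl | hij
    · simp [indicatorExp, hi]
    · simp [indicatorExp, hij.symm]

/-- The fraction `g / (∏ i ∈ I, x_i) ^ N`. -/
def fraction (I : Finset σ) (N : ℕ) (g : MvPolynomial σ k) : Laurent k σ :=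
  toLaurent g * laurentMonomial (-(N • indicatorExp I))

lemma eq_fraction_iff {I : Finset σ} {N : ℕ} {g : MvPolynomial σ k} {l : Laurent k σ} :
    l = fraction I N g ↔ l * laurentMonomial (N • indicatorExp I) = toLaurent g := by
  rw [← (isUnit_laurentMonomial (N • indicatorExp I)).mul_left_inj, fraction, mul_assoc,
    laurentMonomial_neg_mul, mul_one]

lemma toLaurent_mul_fraction (I : Finset σ) (N : ℕ) (f g : MvPolynomial σ k) :
    toLaurent f * fraction I N g = fraction I N (f * g) := by
  rw [fraction, fraction, map_mul, mul_assoc]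

lemma fraction_pow (I : Finset σ) (N p : ℕ) (g : MvPolynomial σ k) :
    fraction I N g ^ p = fraction I (N * p) (g ^ p) := by
  rw [fraction, fraction, mul_pow, map_pow, laurentMonomial_pow, smul_neg, smul_smul, mul_comm p]

lemma fraction_mem_supported_iff {I : Finset σ} {N : ℕ} {g : MvPolynomial σ k}
    {S : Set (σ → ℤ)} : fraction I N g ∈ supported k k S ↔
      ∀ a ∈ g.support, (fun i => a i - if i ∈ I then (N : ℤ) else 0) ∈ S := by
  have hexp (a : σ →₀ ℕ) : exponent a + -(N • indicatorExp I) =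
      fun i => a i - if i ∈ I then (N : ℤ) else 0 := by
    funext i
    simp [indicatorExp, sub_eq_add_neg]
  rw [fraction, mul_laurentMonomial_mem_supported_iff, mem_supported, support_coeff_toLaurent,
    Set.image_subset_iff]
  simp only [← hexp]
  rfl

lemma fraction_mem_supported_sum_iff [Fintype σ] {I : Finset σ} {N : ℕ} {g : MvPolynomial σ k}
    {S : Set ℤ} : fraction I N g ∈ supported k k {z | ∑ i, z i ∈ S} ↔
      ∀ a ∈ g.support, (a.degree : ℤ) - N * I.card ∈ S := by
  have hsum (a : σ →₀ ℕ) :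
      ∑ i, ((a i : ℤ) - if i ∈ I then (N : ℤ) else 0) = a.degree - N * I.card := by
    rw [Finset.sum_sub_distrib, ← sum_exponent]
    simp [mul_comm]
  simp only [fraction_mem_supported_iff, Set.mem_ofPred_eq, hsum]

lemma eventually_exists_fraction_eq [Finite σ] {I : Finset σ} {l : Laurent k σ}
    (h : l ∈ supported k k {z | ∀ i ∉ I, 0 ≤ z i}) :
    ∀ᶠ N in Filter.atTop, ∃ g, fraction I N g = l := by
  have hbound : ∀ᶠ N : ℕ in Filter.atTop, ∀ z ∈ l.coeff.support, ∀ i, 0 ≤ z i + N :=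
    (Filter.eventually_all_finset _).mpr fun z _ => Filter.eventually_all.mpr fun i => by
      filter_upwards [Filter.eventually_ge_atTop (z i).natAbs] with N hN
      omega
  filter_upwards [hbound] with N hN
  obtain ⟨g, hg⟩ := exists_toLaurent_eq (l := l * laurentMonomial (N • indicatorExp I)) <| by
    refine mul_laurentMonomial_mem_supported_iff.mpr fun z hz i => ?_
    by_cases hi : i ∈ I
    · simpa [indicatorExp, hi] using hN z hz i
    · simpa [indicatorExp, hi] using h hz i hi
  exact ⟨g, (eq_fraction_iff.mpr hg.symm).symm⟩

end Fraction

end Laurent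

section Exactness

open AddMonoidAlgebra

variable {k σ : Type*} [CommRing k]

variable (k σ) in
/-- The `q`-th term of the Čech complex of a polynomial ring, as families of Laurent polynomials.
The index is an integer so that `q - 1` makes sense for all `q`. -/
def laurentCochains (q : ℤ) : Submodule k (Finset σ → Laurent k σ) :=
  .pi Set.univ fun J => supported k k {z | (J.card : ℤ) = q ∧ ∀ j ∉ J, 0 ≤ z j}

lemma mem_laurentCochains {q : ℤ} {γ : Finset σ → Laurent k σ} : γ ∈ laurentCochains k σ q ↔
    ∀ J, γ J ∈ supported k k {z | (J.card : ℤ) = q ∧ ∀ j ∉ J, 0 ≤ z j} := by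
  simp [laurentCochains, Submodule.mem_pi]

variable [LinearOrder σ]

lemma contract_mem_laurentCochains {q : ℤ} {γ : Finset σ → Laurent k σ} {i : σ}
    (hγ : γ ∈ laurentCochains k σ q) (hi : ∀ J, γ J ∈ supported k k {z | 0 ≤ z i}) :
    contract i γ ∈ laurentCochains k σ (q - 1) := by
  refine mem_laurentCochains.mpr fun J => ?_
  by_cases hiJ : i ∈ J
  · rw [contract_of_mem γ hiJ]
    exact zero_mem _
  · rw [contract_of_notMem γ hiJ]
    refine zsmul_mem (fun z hz => ?_) _
    obtain ⟨hcard, hz'⟩ := mem_laurentCochains.mp hγ _ hz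
    rw [Finset.card_insert_of_notMem hiJ] at hcard
    refine ⟨by omega, fun j hj => ?_⟩
    rcases eq_or_ne j i with rfl | hji
    · exact hi _ hz
    · exact hz' j (by simp [hji, hj])

/-- Monomials with `0 ≤ z i` form a subcomplex on which contraction with `i` is a null-homotopy;
they are split off one `i ∈ S` at a time. -/
lemma exists_altDiff_eq {q : ℤ} {γ : Finset σ → Laurent k σ} (hγ : γ ∈ laurentCochains k σ q)
    (hd : altDiff γ = 0) (S : Finset σ) (hS : ∀ J, γ J ∈ supported k k {z | ∃ i ∈ S, 0 ≤ z i}) :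
    ∃ η ∈ laurentCochains k σ (q - 1), altDiff η = γ := by
  induction S using Finset.induction_on generalizing γ with
  | empty =>
    have hzero : γ = 0 := funext fun J => eq_zero_of_mem_supported_empty (by simpa using hS J)
    exact ⟨0, zero_mem _, by rw [hzero, map_zero]⟩
  | insert i S _ ih =>
    let γ₁ : Finset σ → Laurent k σ := fun J => truncate {z | 0 ≤ z i} (γ J)
    have hγ₁ : γ₁ ∈ laurentCochains k σ q :=
      mem_laurentCochains.mpr fun J => truncate_mem_of_mem _ (mem_laurentCochains.mp hγ J)
    have hd₁ : altDiff γ₁ = 0 := funext fun J => by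
      rw [← map_altDiff, hd, Pi.zero_apply, map_zero]
    have hrest (J) : (γ - γ₁) J ∈ supported k k {z | ∃ i ∈ S, 0 ≤ z i} := by
      refine supported_mono ?_ (sub_truncate_mem _ (hS J))
      rintro z ⟨⟨j, hj, hz⟩, hi⟩
      rcases Finset.mem_insert.mp hj with rfl | hj
      · exact absurd hz hi
      · exact ⟨j, hj, hz⟩
    obtain ⟨η, hη, hdη⟩ := ih (sub_mem hγ hγ₁) (by rw [map_sub, hd, hd₁, sub_zero]) hrest
    refine ⟨η + contract i γ₁,
      add_mem hη (contract_mem_laurentCochains hγ₁ fun J => truncate_mem _ _), ?_⟩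
    rw [map_add, hdη, altDiff_contract hd₁, sub_add_cancel]

end Exactness

section Fractions

variable {A : Type*} [CommRing A] {m : ℕ} (x : Fin m → A) (I : Finset (Fin m))

/-- The fraction `a / (∏ i ∈ I, x i) ^ N` in `A_I`. -/
def locMk (N : ℕ) (a : A) : Loc x I :=
  Localization.mk a ⟨(∏ i ∈ I, x i) ^ N, pow_mem (Submonoid.mem_powers _) N⟩

variable {x I}

lemma exists_locMk_eq (z : Loc x I) : ∃ N a, locMk x I N a = z := by
  induction z using Localization.induction_on with
  | H y =>
    obtain ⟨a, _, N, rfl⟩ := y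
    exact ⟨N, a, rfl⟩

lemma locMk_mul_pow (N : ℕ) (a : A) :
    locMk x I N a * algebraMap A (Loc x I) (∏ i ∈ I, x i) ^ N = algebraMap A (Loc x I) a := by
  rw [← map_pow, locMk, Localization.mk_eq_mk']
  exact IsLocalization.mk'_spec (M := Submonoid.powers (∏ i ∈ I, x i)) _ a
    ⟨(∏ i ∈ I, x i) ^ N, pow_mem (Submonoid.mem_powers _) N⟩

lemma eq_locMk_iff {z : Loc x I} {N : ℕ} {a : A} : z = locMk x I N a ↔
    z * algebraMap A (Loc x I) (∏ i ∈ I, x i) ^ N = algebraMap A (Loc x I) a := by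
  rw [← ((IsLocalization.Away.algebraMap_isUnit (∏ i ∈ I, x i)).pow N).mul_left_inj, locMk_mul_pow]

lemma locMk_zero (N : ℕ) : locMk x I N 0 = 0 := Localization.mk_zero _

lemma smul_locMk (N : ℕ) (a b : A) : a • locMk x I N b = locMk x I N (a * b) :=
  Localization.smul_mk a b _

lemma locMk_pow (N p : ℕ) (a : A) : locMk x I N a ^ p = locMk x I (N * p) (a ^ p) := by
  rw [eq_locMk_iff, pow_mul, ← mul_pow, locMk_mul_pow, map_pow]

lemma locMk_pow_mul (N M : ℕ) (a : A) :
    locMk x I (N + M) ((∏ i ∈ I, x i) ^ M * a) = locMk x I N a := by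
  rw [eq_comm, eq_locMk_iff, pow_add, ← mul_assoc, locMk_mul_pow, map_mul, map_pow, mul_comm]

lemma locMk_eq_zero_iff {N : ℕ} {a : A} :
    locMk x I N a = 0 ↔ ∃ M, (∏ i ∈ I, x i) ^ M * a = 0 := by
  rw [eq_comm, eq_locMk_iff, zero_mul, eq_comm,
    IsLocalization.map_eq_zero_iff (Submonoid.powers (∏ i ∈ I, x i))]
  simp [Subtype.exists, Submonoid.mem_powers_iff]

end Fractions

section CechToLaurent

open AddMonoidAlgebra

variable {k : Type*} [CommRing k] {m : ℕ}

/-- The variables of the polynomial ring, as the sequence defining its Čech complex. -/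
abbrev polyVar (k : Type*) [CommRing k] (m : ℕ) : Fin m → MvPolynomial (Fin m) k :=
  MvPolynomial.X

/-- The embedding of the localization `R_I` of the polynomial ring into Laurent polynomials. -/
def locToLaurent (I : Finset (Fin m)) : Loc (polyVar k m) I →+* Laurent k (Fin m) :=
  IsLocalization.Away.lift (S := Loc (polyVar k m) I) (g := toLaurent) (∏ i ∈ I, polyVar k m i)
    (by rw [toLaurent_prod_X]; exact isUnit_laurentMonomial _)

lemma locToLaurent_algebraMap (I : Finset (Fin m)) (g : MvPolynomial (Fin m) k) :
    locToLaurent I (algebraMap _ _ g) = toLaurent g := IsLocalization.Away.lift_eq _ _ g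

lemma locToLaurent_locMk (I : Finset (Fin m)) (N : ℕ) (g : MvPolynomial (Fin m) k) :
    locToLaurent I (locMk (polyVar k m) I N g) = fraction I N g := by
  rw [eq_fraction_iff, ← laurentMonomial_pow, ← toLaurent_prod_X, ← locToLaurent_algebraMap I,
    ← locToLaurent_algebraMap I, ← map_pow, ← map_mul, locMk_mul_pow]

lemma locToLaurent_res {I J : Finset (Fin m)} (h : I ⊆ J) (z : Loc (polyVar k m) I) :
    locToLaurent J (res _ h z) = locToLaurent I z := by
  have hcomp : (locToLaurent J).comp (res (polyVar k m) h) = locToLaurent I :=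
    IsLocalization.ringHom_ext (Submonoid.powers (∏ i ∈ I, polyVar k m i)) <|
      RingHom.ext fun g => by simp [res_algebraMap, locToLaurent_algebraMap]
  exact RingHom.congr_fun hcomp z

lemma locToLaurent_injective (I : Finset (Fin m)) :
    Function.Injective (locToLaurent (k := k) I) := by
  refine (injective_iff_map_eq_zero _).mpr fun z hz => ?_
  obtain ⟨N, g, rfl⟩ := exists_locMk_eq z
  rw [locToLaurent_locMk, eq_comm, eq_fraction_iff, zero_mul, ← map_zero toLaurent] at hz
  rw [← toLaurent_injective hz, locMk_zero]

lemma locToLaurent_mem_supported (I : Finset (Fin m)) (z : Loc (polyVar k m) I) :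
    locToLaurent I z ∈ supported k k {w | ∀ j ∉ I, 0 ≤ w j} := by
  obtain ⟨N, g, rfl⟩ := exists_locMk_eq z
  rw [locToLaurent_locMk, fraction_mem_supported_iff]
  intro a _ j hj
  simp [hj]

lemma exists_locToLaurent_eq {I : Finset (Fin m)} {l : Laurent k (Fin m)}
    (h : l ∈ supported k k {w | ∀ j ∉ I, 0 ≤ w j}) : ∃ z, locToLaurent I z = l := by
  obtain ⟨N, g, rfl⟩ := (eventually_exists_fraction_eq h).exists
  exact ⟨_, locToLaurent_locMk I N g⟩

/-- The family of Laurent polynomials underlying a Čech cochain of the polynomial ring. -/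
def cochainToLaurent (q : ℕ) :
    Cochain (polyVar k m) q →+ (Finset (Fin m) → Laurent k (Fin m)) where
  toFun c J := if h : J.card = q then locToLaurent J (c ⟨J, h⟩) else 0
  map_zero' := by funext J; simp
  map_add' c c' := by funext J; by_cases h : J.card = q <;> simp [h]

variable {q : ℕ}

lemma cochainToLaurent_of_card (c : Cochain (polyVar k m) q) {J : Finset (Fin m)}
    (h : J.card = q) : cochainToLaurent q c J = locToLaurent J (c ⟨J, h⟩) := dif_pos h

lemma cochainToLaurent_of_card_ne (c : Cochain (polyVar k m) q) {J : Finset (Fin m)}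
    (h : J.card ≠ q) : cochainToLaurent q c J = 0 := dif_neg h

lemma cochainToLaurent_smul (g : MvPolynomial (Fin m) k) (c : Cochain (polyVar k m) q) :
    cochainToLaurent q (g • c) = toLaurent g • cochainToLaurent q c := by
  funext J
  rw [Pi.smul_apply, smul_eq_mul]
  by_cases h : J.card = q
  · rw [cochainToLaurent_of_card _ h, cochainToLaurent_of_card _ h, Pi.smul_apply,
      Algebra.smul_def, map_mul, locToLaurent_algebraMap]
  · rw [cochainToLaurent_of_card_ne _ h, cochainToLaurent_of_card_ne _ h, mul_zero]

lemma cochainToLaurent_injective :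
    Function.Injective (cochainToLaurent (k := k) (m := m) q) := by
  refine fun c c' h => funext fun ⟨J, hJ⟩ => locToLaurent_injective J ?_
  rw [← cochainToLaurent_of_card c hJ, ← cochainToLaurent_of_card c' hJ, h]

lemma cochainToLaurent_mem (c : Cochain (polyVar k m) q) :
    cochainToLaurent q c ∈ laurentCochains k (Fin m) q := by
  refine mem_laurentCochains.mpr fun J => ?_
  by_cases hJ : J.card = q
  · rw [cochainToLaurent_of_card c hJ]
    exact fun z hz => ⟨congrArg Nat.cast hJ, locToLaurent_mem_supported J _ hz⟩
  · rw [cochainToLaurent_of_card_ne c hJ]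
    exact zero_mem _

lemma exists_cochainToLaurent_eq {γ : Finset (Fin m) → Laurent k (Fin m)}
    (hγ : γ ∈ laurentCochains k (Fin m) q) : ∃ c, cochainToLaurent q c = γ := by
  rw [mem_laurentCochains] at hγ
  choose c hc using fun J => exists_locToLaurent_eq (supported_mono (fun _ hz => hz.2) (hγ J))
  refine ⟨fun J => c J.1, funext fun J => ?_⟩
  by_cases hJ : J.card = q
  · rw [cochainToLaurent_of_card _ hJ, hc]
  · rw [cochainToLaurent_of_card_ne _ hJ, eq_comm]
    refine eq_zero_of_mem_supported_empty (supported_mono ?_ (hγ J))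
    exact fun z hz => hJ (Nat.cast_injective hz.1)

lemma cochainToLaurent_diff (c : Cochain (polyVar k m) q) :
    cochainToLaurent (q + 1) (diff _ q c) = altDiff (cochainToLaurent q c) := by
  funext J
  rw [altDiff_apply]
  by_cases hJ : J.card = q + 1
  · rw [cochainToLaurent_of_card _ hJ, ← Finset.sum_coe_sort]
    simp only [diff, LinearMap.coe_mk, AddHom.coe_mk, map_sum, map_mul, map_pow, map_neg, map_one]
    refine Finset.sum_congr rfl fun j _ => ?_
    have hj : (J.erase j.1).card = q := by rw [Finset.card_erase_of_mem j.2, hJ]; rfl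
    rw [cochainToLaurent_of_card _ hj, locToLaurent_res, posSign, zsmul_eq_mul]
    push_cast
    rfl
  · rw [cochainToLaurent_of_card_ne _ hJ, Finset.sum_eq_zero]
    intro j hj
    rw [cochainToLaurent_of_card_ne, smul_zero]
    have := Finset.card_erase_add_one hj
    omega

lemma mem_coboundaries_of_altDiff_eq_zero (hq : q < m) {c : Cochain (polyVar k m) q}
    (hc : altDiff (cochainToLaurent q c) = 0) : c ∈ coboundaries (polyVar k m) q := by
  obtain ⟨η, hη, hd⟩ := exists_altDiff_eq (cochainToLaurent_mem c) hc Finset.univ fun J => by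
    refine supported_mono ?_ (mem_laurentCochains.mp (cochainToLaurent_mem c) J)
    rintro z ⟨hJ, hz⟩
    obtain ⟨i, hi⟩ : ∃ i, i ∉ J := by
      by_contra! h
      rw [Finset.eq_univ_of_forall h, Finset.card_univ, Fintype.card_fin] at hJ
      omega
    exact ⟨i, Finset.mem_univ i, hz i hi⟩
  cases q with
  | zero =>
    have hη0 : η = 0 := funext fun J => eq_zero_of_mem_supported_empty <|
      supported_mono (fun z hz => by have := hz.1; omega)
        (mem_laurentCochains.mp hη J)
    exact cochainToLaurent_injective (by rw [← hd, hη0, map_zero, map_zero])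
  | succ q =>
    obtain ⟨b, rfl⟩ := exists_cochainToLaurent_eq (q := q) (by simpa using hη)
    exact ⟨b, cochainToLaurent_injective (by rw [cochainToLaurent_diff, hd])⟩

end CechToLaurent

section CechFunctoriality

variable {A B : Type*} [CommRing A] [CommRing B] {m : ℕ} {x : Fin m → A} {y : Fin m → B}
  {φ : A →+* B} (h : ∀ i, φ (x i) = y i)

include h in
lemma map_prod_eq (I : Finset (Fin m)) : φ (∏ i ∈ I, x i) = ∏ i ∈ I, y i := by
  rw [map_prod, Finset.prod_congr rfl fun i _ => h i]

/-- The ring homomorphism `A_I → B_I` induced by `φ : A → B` with `φ (x i) = y i`. -/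
def locMap (I : Finset (Fin m)) : Loc x I →+* Loc y I :=
  IsLocalization.Away.lift (S := Loc x I) (g := (algebraMap B (Loc y I)).comp φ) (∏ i ∈ I, x i)
    (by rw [RingHom.comp_apply, map_prod_eq h]; exact IsLocalization.Away.algebraMap_isUnit _)

lemma locMap_algebraMap (I : Finset (Fin m)) (a : A) :
    locMap h I (algebraMap A _ a) = algebraMap B _ (φ a) := IsLocalization.Away.lift_eq _ _ a

lemma locMap_locMk (I : Finset (Fin m)) (N : ℕ) (a : A) :
    locMap h I (locMk x I N a) = locMk y I N (φ a) := by
  have hN := congrArg (locMap h I) (locMk_mul_pow N a)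
  rw [map_mul, map_pow, locMap_algebraMap, locMap_algebraMap, map_prod_eq h] at hN
  exact eq_locMk_iff.mpr hN

lemma locMap_res {I J : Finset (Fin m)} (hIJ : I ⊆ J) (z : Loc x I) :
    locMap h J (res _ hIJ z) = res _ hIJ (locMap h I z) := by
  have hcomp : (locMap h J).comp (res x hIJ) = (res y hIJ).comp (locMap h I) :=
    IsLocalization.ringHom_ext (Submonoid.powers (∏ i ∈ I, x i)) <|
      RingHom.ext fun a => by simp [res_algebraMap, locMap_algebraMap]
  exact RingHom.congr_fun hcomp z

lemma locMap_surjective (hφ : Function.Surjective φ) (I : Finset (Fin m)) :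
    Function.Surjective (locMap h I) := by
  intro z
  obtain ⟨N, b, rfl⟩ := exists_locMk_eq z
  obtain ⟨a, rfl⟩ := hφ b
  exact ⟨_, locMap_locMk h I N a⟩

lemma exists_eq_smul_of_locMap_eq_zero {f : A} (hφ : RingHom.ker φ = Ideal.span {f})
    {I : Finset (Fin m)} {z : Loc x I} (hz : locMap h I z = 0) : ∃ w, z = f • w := by
  obtain ⟨N, a, rfl⟩ := exists_locMk_eq z
  obtain ⟨M, hM⟩ := locMk_eq_zero_iff.mp ((locMap_locMk h I N a).symm.trans hz)
  rw [← map_prod_eq h, ← map_pow, ← map_mul, ← RingHom.mem_ker, hφ,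
    Ideal.mem_span_singleton] at hM
  obtain ⟨b, hb⟩ := hM
  exact ⟨locMk x I (N + M) b, by rw [smul_locMk, ← hb, locMk_pow_mul]⟩

/-- The map on Čech cochains induced by a ring homomorphism. -/
def cochainMap (q : ℕ) : Cochain x q →+ Cochain y q where
  toFun c I := locMap h I.1 (c I)
  map_zero' := funext fun _ => map_zero _
  map_add' _ _ := funext fun _ => map_add _ _ _

variable {q : ℕ}

lemma cochainMap_surjective (hφ : Function.Surjective φ) :
    Function.Surjective (cochainMap h q) := by
  intro c
  choose b hb using fun I : {I : Finset (Fin m) // I.card = q} => locMap_surjective h hφ I.1 (c I)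
  exact ⟨b, funext hb⟩

lemma cochainMap_smul (a : A) (c : Cochain x q) :
    cochainMap h q (a • c) = φ a • cochainMap h q c := by
  funext I
  change locMap h I.1 (a • c I) = φ a • locMap h I.1 (c I)
  rw [Algebra.smul_def, map_mul, locMap_algebraMap, Algebra.smul_def]

lemma cochainMap_eq_zero_iff {f : A} (hφ : RingHom.ker φ = Ideal.span {f}) {c : Cochain x q} :
    cochainMap h q c = 0 ↔ ∃ b : Cochain x q, c = f • b := by
  constructor
  · intro hc
    choose b hb using fun I => exists_eq_smul_of_locMap_eq_zero h hφ (congrFun hc I)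
    exact ⟨b, funext hb⟩
  · rintro ⟨b, rfl⟩
    have hf : φ f = 0 := by
      rw [← RingHom.mem_ker, hφ]
      exact Ideal.mem_span_singleton_self f
    rw [cochainMap_smul, hf, zero_smul]

lemma diff_cochainMap (c : Cochain x q) :
    diff _ q (cochainMap h q c) = cochainMap h (q + 1) (diff _ q c) := by
  funext J
  simp only [diff, cochainMap, AddMonoidHom.coe_mk, ZeroHom.coe_mk, LinearMap.coe_mk,
    AddHom.coe_mk, map_sum, map_mul, map_pow, map_neg, map_one, locMap_res]

lemma cochainMap_mem_coboundaries {c : Cochain x q} (hc : c ∈ coboundaries x q) :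
    cochainMap h q c ∈ coboundaries y q := by
  cases q with
  | zero =>
    rw [show c = 0 from hc, map_zero]
    exact zero_mem _
  | succ q =>
    obtain ⟨b, rfl⟩ := hc
    exact ⟨cochainMap h q b, diff_cochainMap h b⟩

lemma exists_coboundary_of_mem_coboundaries (hφ : Function.Surjective φ) {c : Cochain y q}
    (hc : c ∈ coboundaries y q) : ∃ b ∈ coboundaries x q, cochainMap h q b = c := by
  cases q with
  | zero => exact ⟨0, zero_mem _, by rw [show c = 0 from hc, map_zero]⟩
  | succ q =>
    obtain ⟨b, rfl⟩ := hc
    obtain ⟨b, rfl⟩ := cochainMap_surjective h hφ b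
    exact ⟨diff _ q b, ⟨b, rfl⟩, (diff_cochainMap h b).symm⟩

lemma cochainMap_frobCochain {p : ℕ} [Fact p.Prime] (hA : (p : A) = 0) (hB : (p : B) = 0)
    (c : Cochain x q) :
    cochainMap h q (frobCochain x p hA q c) = frobCochain y p hB q (cochainMap h q c) :=
  funext fun I => map_pow (locMap h I.1) (c I) p

end CechFunctoriality

section FrobeniusDegree

variable {A : Type*} [CommRing A] {m : ℕ} {x : Fin m → A} {𝒜 : ℕ → AddSubgroup A}

lemma cohomologyLT_induction {q : ℕ} {N : ℤ} {C : Cohomology x q → Prop}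
    (mem : ∀ j < N, ∀ ξ ∈ cohomologyDegree x 𝒜 q j, C ξ) (zero : C 0)
    (add : ∀ ξ ξ', C ξ → C ξ' → C (ξ + ξ')) {ξ : Cohomology x q} (hξ : ξ ∈ cohomologyLT x 𝒜 q N) :
    C ξ :=
  AddSubgroup.iSup_induction _ (C := C) hξ (fun j => mem j.1 j.2) zero add

variable {p : ℕ} [Fact p.Prime] (hA : (p : A) = 0)
  (h𝒜 : ∀ r, ∀ a ∈ 𝒜 r, a ^ p ∈ 𝒜 (r * p))
include h𝒜

lemma frob_mem_locDegree {j : ℤ} {I : Finset (Fin m)} {z : Loc x I}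
    (hz : z ∈ locDegree x 𝒜 j I) :
    frob p _ (natCast_loc x p hA I) z ∈ locDegree x 𝒜 (p * j) I := by
  induction hz using AddSubgroup.closure_induction with
  | mem z hz =>
    obtain ⟨N, r, a, ha, hr, rfl⟩ := hz
    refine AddSubgroup.subset_closure ⟨N * p, r * p, a ^ p, h𝒜 r a ha, ?_, locMk_pow N p a⟩
    push_cast
    rw [hr]; ring
  | zero => rw [map_zero]; exact zero_mem _
  | add x y _ _ hx hy => rw [map_add]; exact add_mem hx hy
  | neg x _ hx => rw [map_neg]; exact neg_mem hx

lemma frobCohomology_mem_cohomologyDegree {q : ℕ} {j : ℤ} {ξ : Cohomology x q}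
    (hξ : ξ ∈ cohomologyDegree x 𝒜 q j) :
    frobCohomology x p hA q ξ ∈ cohomologyDegree x 𝒜 q (p * j) := by
  obtain ⟨c, hc, rfl⟩ := hξ
  exact ⟨frobCocycles x p hA q c, fun I => frob_mem_locDegree hA h𝒜 (hc I), rfl⟩

lemma frobCohomology_mapsTo (q : ℕ) (N : ℤ) :
    Set.MapsTo (frobCohomology x p hA q) (cohomologyLT x 𝒜 q N) (cohomologyLT x 𝒜 q (p * N)) := by
  have hp : (0 : ℤ) < p := by exact_mod_cast (Fact.out : p.Prime).pos
  intro ξ hξ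
  refine cohomologyLT_induction (C := fun ξ => frobCohomology x p hA q ξ ∈ _) ?_ ?_ ?_ hξ
  · intro j hj ξ hξ
    exact AddSubgroup.mem_iSup_of_mem (⟨p * j, by gcongr⟩ : {j : ℤ // j < p * N})
      (frobCohomology_mem_cohomologyDegree hA h𝒜 hξ)
  · rw [map_zero]; exact zero_mem _
  · intro ξ ξ' hξ hξ'
    rw [map_add]; exact add_mem hξ hξ'

end FrobeniusDegree

lemma hypFrob_mapsTo {k : Type u} [Field k] {n p : ℕ} [Fact p.Prime] [CharP k p] (f : Poly k n)
    (q : ℕ) (N : ℤ) : Set.MapsTo (hypFrob p f q) (hypLCLT f q N) (hypLCLT f q (p * N)) := by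
  refine frobCohomology_mapsTo (natCast_hyp p f) ?_ q N
  rintro r _ ⟨g, hg, rfl⟩
  exact ⟨g ^ p, MvPolynomial.IsHomogeneous.pow hg p,
    map_pow (Ideal.Quotient.mk (Ideal.span {f})) g p⟩

section TopDifferential

open AddMonoidAlgebra

variable {k : Type*} [CommRing k] {n : ℕ}

/-- The Čech differential `⨁ R_{x₀ ⋯ x̂ᵢ ⋯ xₙ} → R_{x₀ ⋯ xₙ}` whose cokernel is the top local
cohomology of the polynomial ring, with values read as Laurent polynomials. -/
def topDiff : Cochain (polyVar k (n + 1)) n →+ Laurent k (Fin (n + 1)) :=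
  (Pi.evalAddMonoidHom _ Finset.univ).comp (altDiff.comp (cochainToLaurent n))

lemma topDiff_apply (c : Cochain (polyVar k (n + 1)) n) :
    topDiff c = altDiff (cochainToLaurent n c) Finset.univ := rfl

lemma topDiff_eq_locToLaurent (c : Cochain (polyVar k (n + 1)) n) :
    topDiff c = locToLaurent Finset.univ (diff _ n c ⟨Finset.univ, Finset.card_fin _⟩) := by
  rw [topDiff_apply, ← cochainToLaurent_diff, cochainToLaurent_of_card]

lemma topDiff_smul (g : MvPolynomial (Fin (n + 1)) k) (c : Cochain (polyVar k (n + 1)) n) :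
    topDiff (g • c) = toLaurent g * topDiff c := by
  rw [topDiff_apply, cochainToLaurent_smul, altDiff_smul, Pi.smul_apply, smul_eq_mul,
    topDiff_apply]

lemma topDiff_frobCochain {p : ℕ} [Fact p.Prime]
    (hR : (p : MvPolynomial (Fin (n + 1)) k) = 0) (c : Cochain (polyVar k (n + 1)) n) :
    topDiff (frobCochain _ p hR n c) = topDiff c ^ p := by
  rw [topDiff_eq_locToLaurent, diff_frobCochain, topDiff_eq_locToLaurent, ← map_pow]
  rfl

lemma altDiff_cochainToLaurent (c : Cochain (polyVar k (n + 1)) n) :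
    altDiff (cochainToLaurent n c) = Pi.single Finset.univ (topDiff c) := by
  funext J
  by_cases hJ : J = Finset.univ
  · rw [hJ, Pi.single_eq_same, topDiff_apply]
  · rw [Pi.single_eq_of_ne hJ, ← cochainToLaurent_diff, cochainToLaurent_of_card_ne]
    exact fun h => hJ (Finset.eq_univ_of_card J (h.trans (Fintype.card_fin _).symm))

lemma topDiff_eq_zero_iff {c : Cochain (polyVar k (n + 1)) n} :
    topDiff c = 0 ↔ c ∈ coboundaries (polyVar k (n + 1)) n := by
  constructor
  · intro h
    refine mem_coboundaries_of_altDiff_eq_zero (Nat.lt_succ_self n) ?_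
    rw [altDiff_cochainToLaurent, h, Pi.single_zero]
  · intro h
    cases n with
    | zero => rw [show c = 0 from h, map_zero]
    | succ n =>
      obtain ⟨b, rfl⟩ := h
      rw [topDiff_apply, cochainToLaurent_diff, altDiff_altDiff, Pi.zero_apply]

lemma topDiff_mem_supported (c : Cochain (polyVar k (n + 1)) n) :
    topDiff c ∈ supported k k {z | ∃ i, 0 ≤ z i} := by
  rw [topDiff_apply, altDiff_apply]
  refine Submodule.sum_mem _ fun j _ => zsmul_mem (supported_mono ?_ <|
    mem_laurentCochains.mp (cochainToLaurent_mem c) (Finset.univ.erase j)) _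
  exact fun z hz => ⟨j, hz.2 j (Finset.notMem_erase j _)⟩

lemma single_univ_mem_laurentCochains (l : Laurent k (Fin (n + 1))) :
    Pi.single Finset.univ l ∈ laurentCochains k (Fin (n + 1)) (n + 1 : ℕ) := by
  refine mem_laurentCochains.mpr fun J => ?_
  by_cases hJ : J = Finset.univ
  · intro z _
    simp [hJ]
  · rw [Pi.single_eq_of_ne hJ]
    exact zero_mem _

lemma altDiff_single_univ (l : Laurent k (Fin (n + 1))) :
    altDiff (Pi.single (Finset.univ : Finset (Fin (n + 1))) l) = 0 := by
  funext J
  rw [altDiff_apply, Finset.sum_eq_zero, Pi.zero_apply]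
  intro j _
  have hne : J.erase j ≠ Finset.univ := fun h => Finset.notMem_erase j J (h ▸ Finset.mem_univ j)
  rw [Pi.single_eq_of_ne hne, smul_zero]

lemma exists_topDiff_eq {l : Laurent k (Fin (n + 1))}
    (hl : l ∈ supported k k {z | ∃ i, 0 ≤ z i}) : ∃ c, topDiff c = l := by
  obtain ⟨η, hη, hd⟩ := exists_altDiff_eq (single_univ_mem_laurentCochains l)
    (altDiff_single_univ l) Finset.univ fun J => by
      by_cases hJ : J = Finset.univ
      · rw [hJ, Pi.single_eq_same]
        simpa using hl
      · rw [Pi.single_eq_of_ne hJ]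
        exact zero_mem _
  obtain ⟨c, rfl⟩ := exists_cochainToLaurent_eq (q := n) (by simpa using hη)
  exact ⟨c, by rw [topDiff_apply, hd, Pi.single_eq_same]⟩

lemma truncate_topDiff (S : Set (Fin (n + 1) → ℤ)) (c : Cochain (polyVar k (n + 1)) n) :
    truncate S (topDiff c) =
      altDiff (fun J => truncate S (cochainToLaurent n c J)) Finset.univ :=
  map_altDiff (truncate S) (cochainToLaurent n c) Finset.univ

lemma truncate_topDiff_eq_self {S : Set (Fin (n + 1) → ℤ)} {c : Cochain (polyVar k (n + 1)) n}
    (hc : ∀ J, cochainToLaurent n c J ∈ supported k k S) : truncate S (topDiff c) = topDiff c := by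
  rw [truncate_topDiff, funext fun J => truncate_eq_self (hc J), topDiff_apply]

lemma exists_topDiff_eq_truncate (S : Set (Fin (n + 1) → ℤ))
    (c : Cochain (polyVar k (n + 1)) n) :
    ∃ c', (∀ J, cochainToLaurent n c' J ∈ supported k k S) ∧
      topDiff c' = truncate S (topDiff c) := by
  obtain ⟨c', hc'⟩ : ∃ c', cochainToLaurent n c' = fun J => truncate S (cochainToLaurent n c J) :=
    exists_cochainToLaurent_eq <| mem_laurentCochains.mpr fun J =>
      truncate_mem_of_mem S (mem_laurentCochains.mp (cochainToLaurent_mem c) J)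
  refine ⟨c', fun J => ?_, ?_⟩
  · rw [hc']
    exact truncate_mem S _
  · rw [truncate_topDiff, topDiff_apply, hc']

end TopDifferential

section Reduction

open AddMonoidAlgebra

variable {k : Type u} [Field k] {n : ℕ} (f : Poly k n)

lemma mk_polyVar (i : Fin (n + 1)) :
    Ideal.Quotient.mk (Ideal.span {f}) (polyVar k (n + 1) i) = hypVar f i := rfl

/-- Reduction modulo `f` on the localizations at products of variables. -/
abbrev reduceLoc (I : Finset (Fin (n + 1))) : Loc (polyVar k (n + 1)) I →+* Loc (hypVar f) I :=
  locMap (mk_polyVar f) I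

/-- Reduction modulo `f` on Čech cochains. -/
abbrev reduceCochain (q : ℕ) : Cochain (polyVar k (n + 1)) q →+ Cochain (hypVar f) q :=
  cochainMap (mk_polyVar f) q

lemma exists_of_mem_locDegree {j : ℤ} {I : Finset (Fin (n + 1))} {y : Loc (hypVar f) I}
    (hy : y ∈ locDegree (hypVar f) (hypGrading f) j I) :
    ∃ z, reduceLoc f I z = y ∧ locToLaurent I z ∈ supported k k {w | ∑ i, w i = j} := by
  induction hy using AddSubgroup.closure_induction with
  | mem y hy =>
    obtain ⟨N, r, _, ⟨g, hg, rfl⟩, hr, rfl⟩ := hy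
    refine ⟨locMk _ I N g, locMap_locMk _ I N g, ?_⟩
    rw [locToLaurent_locMk]
    refine (fraction_mem_supported_sum_iff (S := {j})).mpr fun a ha => ?_
    have hdeg : a.degree = r := (hg.degree_eq_sum_deg_support ha).symm
    rw [hdeg, hr, add_sub_cancel_right, Set.mem_singleton_iff]
  | zero => exact ⟨0, map_zero _, by rw [map_zero]; exact zero_mem _⟩
  | add x y _ _ hx hy =>
    obtain ⟨z, rfl, hz⟩ := hx
    obtain ⟨w, rfl, hw⟩ := hy
    exact ⟨z + w, map_add _ _ _, by rw [map_add]; exact add_mem hz hw⟩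
  | neg x _ hx =>
    obtain ⟨z, rfl, hz⟩ := hx
    exact ⟨-z, map_neg _ _, by rw [map_neg]; exact neg_mem hz⟩

lemma reduceLoc_mem_locDegree {j : ℤ} {I : Finset (Fin (n + 1))}
    {z : Loc (polyVar k (n + 1)) I} (hz : locToLaurent I z ∈ supported k k {w | ∑ i, w i = j}) :
    reduceLoc f I z ∈ locDegree (hypVar f) (hypGrading f) j I := by
  obtain ⟨N, g, rfl⟩ := exists_locMk_eq z
  rw [locToLaurent_locMk] at hz
  replace hz := (fraction_mem_supported_sum_iff (S := {j})).mp hz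
  rw [locMap_locMk]
  rcases g.support.eq_empty_or_nonempty with hg | ⟨a, ha⟩
  · rw [MvPolynomial.support_eq_empty.mp hg, map_zero, locMk_zero]
    exact zero_mem _
  · refine AddSubgroup.subset_closure ⟨N, a.degree, _, ⟨g, ?_, rfl⟩, ?_, rfl⟩
    · intro b hb
      have hdeg : b.degree = a.degree := Nat.cast_injective <| sub_left_injective <|
        (hz b (MvPolynomial.mem_support_iff.mpr hb)).trans (hz a ha).symm
      exact (DFunLike.congr_fun Finsupp.degree_eq_weight_one b).symm.trans hdeg
    · exact sub_eq_iff_eq_add.mp (hz a ha)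

lemma exists_cochain_of_mem_locDegree {q : ℕ} {j : ℤ} {c : Cochain (hypVar f) q}
    (hc : ∀ I, c I ∈ locDegree (hypVar f) (hypGrading f) j I.1) :
    ∃ b, reduceCochain f q b = c ∧
      ∀ J, cochainToLaurent q b J ∈ supported k k {w | ∑ i, w i = j} := by
  choose b hb hdeg using fun I => exists_of_mem_locDegree f (hc I)
  refine ⟨b, funext hb, fun J => ?_⟩
  by_cases hJ : J.card = q
  · rw [cochainToLaurent_of_card _ hJ]
    exact hdeg ⟨J, hJ⟩
  · rw [cochainToLaurent_of_card_ne _ hJ]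
    exact zero_mem _

lemma reduceCochain_mem_cocycles_iff {c : Cochain (polyVar k (n + 1)) n} :
    reduceCochain f n c ∈ cocycles (hypVar f) n ↔ ∃ l, topDiff c = toLaurent f * l := by
  rw [cocycles, LinearMap.mem_ker, diff_cochainMap, cochainMap_eq_zero_iff _ Ideal.mk_ker]
  constructor
  · rintro ⟨b, hb⟩
    exact ⟨cochainToLaurent (n + 1) b Finset.univ, by
      rw [topDiff_apply, ← cochainToLaurent_diff, hb, cochainToLaurent_smul, Pi.smul_apply,
        smul_eq_mul]⟩
  · rintro ⟨l, hl⟩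
    obtain ⟨b, hb⟩ := exists_cochainToLaurent_eq (single_univ_mem_laurentCochains l)
    refine ⟨b, cochainToLaurent_injective ?_⟩
    rw [cochainToLaurent_diff, altDiff_cochainToLaurent, hl, cochainToLaurent_smul, hb,
      ← Pi.single_smul, smul_eq_mul]

end Reduction

section Connecting

open AddMonoidAlgebra

lemma cohomology_mk_eq_zero_iff {A : Type*} [CommRing A] {m q : ℕ} {x : Fin m → A}
    {c : Cochain x q} (hc : c ∈ cocycles x q) :
    (Submodule.Quotient.mk ⟨c, hc⟩ : Cohomology x q) = 0 ↔ c ∈ coboundaries x q :=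
  Submodule.Quotient.mk_eq_zero _

variable {k : Type u} [Field k] {n : ℕ} {f : Poly k n}

/-- The connecting homomorphism of `0 → R → R → R/fR → 0` sends `ξ ∈ H^n_𝔪(R/fR)` to the class of
the Laurent polynomial `l` in `H^{n+1}_𝔪(R)`. This is a relation because only `l` modulo the image
of `topDiff` is determined by `ξ`. -/
def IsConnecting (f : Poly k n) (ξ : HypLC f n) (l : Laurent k (Fin (n + 1))) : Prop :=
  ∃ (c : Cochain (polyVar k (n + 1)) n) (h : reduceCochain f n c ∈ cocycles (hypVar f) n),
    (Submodule.Quotient.mk ⟨reduceCochain f n c, h⟩ : HypLC f n) = ξ ∧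
      topDiff c = toLaurent f * l

variable {ξ ξ' : HypLC f n} {l l' : Laurent k (Fin (n + 1))}

lemma isConnecting_zero : IsConnecting f 0 0 := by
  refine ⟨0, by rw [map_zero]; exact zero_mem _, ?_, by rw [map_zero, mul_zero]⟩
  rw [cohomology_mk_eq_zero_iff, map_zero]
  exact zero_mem _

lemma IsConnecting.add (h : IsConnecting f ξ l) (h' : IsConnecting f ξ' l') :
    IsConnecting f (ξ + ξ') (l + l') := by
  obtain ⟨c, hc, rfl, hl⟩ := h
  obtain ⟨c', hc', rfl, hl'⟩ := h'
  have hadd := map_add (reduceCochain f n) c c'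
  refine ⟨c + c', hadd ▸ add_mem hc hc', ?_, by rw [map_add, hl, hl', mul_add]⟩
  rw [← Submodule.Quotient.mk_add]
  exact congrArg _ (Subtype.ext hadd)

lemma IsConnecting.eq_zero_iff (hf : f ≠ 0) (h : IsConnecting f ξ l) :
    ξ = 0 ↔ l ∈ supported k k {z | ∃ i, 0 ≤ z i} := by
  obtain ⟨c, hc, rfl, hl⟩ := h
  have hf' : toLaurent f ≠ 0 := (map_ne_zero_iff _ toLaurent_injective).mpr hf
  rw [cohomology_mk_eq_zero_iff]
  constructor
  · intro hcob
    obtain ⟨b, hb, hbc⟩ := exists_coboundary_of_mem_coboundaries _ Ideal.Quotient.mk_surjective hcob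
    have hcb : reduceCochain f n (c - b) = 0 :=
      (map_sub (reduceCochain f n) c b).trans (sub_eq_zero.mpr hbc.symm)
    obtain ⟨e, he⟩ := (cochainMap_eq_zero_iff (mk_polyVar f) Ideal.mk_ker).mp hcb
    have hle : toLaurent f * topDiff e = toLaurent f * l := by
      rw [← topDiff_smul, ← he, map_sub, topDiff_eq_zero_iff.mpr hb, sub_zero, hl]
    rw [← mul_left_cancel₀ hf' hle]
    exact topDiff_mem_supported e
  · intro hmem
    obtain ⟨e, rfl⟩ := exists_topDiff_eq hmem
    have hcob : c - f • e ∈ coboundaries (polyVar k (n + 1)) n := by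
      rw [← topDiff_eq_zero_iff, map_sub, topDiff_smul, hl, sub_self]
    have hred : reduceCochain f n (f • e) = 0 :=
      (cochainMap_eq_zero_iff (mk_polyVar f) Ideal.mk_ker).mpr ⟨e, rfl⟩
    have hmap := cochainMap_mem_coboundaries (mk_polyVar f) hcob
    rwa [map_sub, hred, sub_zero] at hmap

lemma IsConnecting.hypFrob {p : ℕ} [Fact p.Prime] [CharP k p] (h : IsConnecting f ξ l) :
    IsConnecting f (hypFrob p f n ξ) (toLaurent f ^ (p - 1) * l ^ p) := by
  obtain ⟨c, hc, rfl, hl⟩ := h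
  have hR : (p : Poly k n) = 0 := CharP.cast_eq_zero _ _
  have hred := cochainMap_frobCochain (mk_polyVar f) hR (natCast_hyp p f) c
  refine ⟨frobCochain _ p hR n c, ?_, ?_, ?_⟩
  · exact hred ▸ frobCochain_mem_cocycles (hypVar f) p (natCast_hyp p f) n ⟨_, hc⟩
  · exact congrArg Submodule.Quotient.mk (Subtype.ext hred)
  · rw [topDiff_frobCochain, hl, mul_pow, ← mul_assoc, mul_pow_sub_one (Fact.out : p.Prime).ne_zero]

variable {d : ℕ} (hf : f.IsHomogeneous d) {j : ℤ}
include hf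

lemma truncate_toLaurent_mul (j : ℤ) (l : Laurent k (Fin (n + 1))) :
    truncate {z | ∑ i, z i = j} (toLaurent f * l) =
      toLaurent f * truncate {z | ∑ i, z i = j - d} l := by
  refine truncate_mul (toLaurent_mem_supported_sum hf) fun z hz w => ?_
  have hz : ∑ i, z i = d := hz
  simp only [Set.mem_ofPred_eq, Pi.add_apply, Finset.sum_add_distrib, hz]
  omega

lemma exists_isConnecting_of_mem_degree (hξ : ξ ∈ hypLCDegree f n j) :
    ∃ l, IsConnecting f ξ l ∧ l ∈ supported k k {z | ∑ i, z i = j - d} := by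
  obtain ⟨⟨_, hc'⟩, hdeg, rfl⟩ := hξ
  obtain ⟨c, rfl, hc⟩ := exists_cochain_of_mem_locDegree f hdeg
  obtain ⟨l, hl⟩ := (reduceCochain_mem_cocycles_iff f).mp hc'
  refine ⟨truncate _ l, ⟨c, hc', rfl, ?_⟩, truncate_mem _ l⟩
  rw [← truncate_toLaurent_mul hf, ← hl, truncate_topDiff_eq_self hc]

lemma exists_mem_degree_isConnecting (hl : l ∈ supported k k {z | ∑ i, z i = j - d})
    (hfl : toLaurent f * l ∈ supported k k {z | ∃ i, 0 ≤ z i}) :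
    ∃ ξ ∈ hypLCDegree f n j, IsConnecting f ξ l := by
  obtain ⟨c₀, hc₀⟩ := exists_topDiff_eq hfl
  obtain ⟨c, hdeg, hc⟩ := exists_topDiff_eq_truncate {z | ∑ i, z i = j} c₀
  rw [hc₀, truncate_toLaurent_mul hf, truncate_eq_self hl] at hc
  have hcocycle := (reduceCochain_mem_cocycles_iff f).mpr ⟨l, hc⟩
  refine ⟨Submodule.Quotient.mk ⟨_, hcocycle⟩, ⟨⟨_, hcocycle⟩, fun I => ?_, rfl⟩,
    c, hcocycle, rfl, hc⟩
  refine reduceLoc_mem_locDegree f ?_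
  rw [← cochainToLaurent_of_card c I.2]
  exact hdeg I.1

lemma exists_isConnecting_of_mem_LT {N : ℤ} (hξ : ξ ∈ hypLCLT f n N) :
    ∃ l, IsConnecting f ξ l ∧ l ∈ supported k k {z | ∑ i, z i ∈ Set.Iio (N - d)} := by
  let C : HypLC f n → Prop := fun ξ => ∃ l, IsConnecting f ξ l ∧
    l ∈ supported k k {z | ∑ i, z i ∈ Set.Iio (N - d)}
  refine cohomologyLT_induction (C := C) ?_ ?_ ?_ hξ
  · intro j hj ξ hξ
    obtain ⟨l, hconn, hdeg⟩ := exists_isConnecting_of_mem_degree hf hξ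
    exact ⟨l, hconn, supported_mono (fun z hz => hz.trans_lt (sub_lt_sub_right hj _)) hdeg⟩
  · exact ⟨0, isConnecting_zero, zero_mem _⟩
  · rintro x y ⟨l, hconn, hdeg⟩ ⟨l', hconn', hdeg'⟩
    exact ⟨l + l', hconn.add hconn', add_mem hdeg hdeg'⟩

end Connecting

section FrobeniusKernel

open AddMonoidAlgebra

variable {k : Type u} [Field k] {n p : ℕ} {f : Poly k n}

lemma exists_fraction_univ_eq (p : ℕ) [Fact p.Prime] (l : Laurent k (Fin (n + 1))) :
    ∃ (e : ℕ) (g : Poly k n), fraction Finset.univ (p ^ e) g = l :=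
  ((tendsto_pow_atTop_atTop_of_one_lt (Fact.out : p.Prime).one_lt).eventually
    (eventually_exists_fraction_eq fun _ _ i hi => absurd (Finset.mem_univ i) hi)).exists

variable [Fact p.Prime] [CharP k p] {ξ : HypLC f n} {e : ℕ} {g : Poly k n} {d : ℕ} {δ : ℤ}

lemma fraction_univ_mem_supported_iff :
    fraction Finset.univ (p ^ e) g ∈ supported k k {z | ∃ i, 0 ≤ z i} ↔
      g ∈ frobPower p (maxIdeal k n) e := by
  rw [fraction_mem_supported_iff, mem_frobPower_maxIdeal_iff]
  simp only [Set.mem_ofPred_eq, Finset.mem_univ, if_true, sub_nonneg, Nat.cast_le]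

lemma hypFrob_eq_zero_iff (hf0 : f ≠ 0)
    (h : IsConnecting f ξ (fraction Finset.univ (p ^ e) g)) :
    hypFrob p f n ξ = 0 ↔
      g ∈ (frobPower p (maxIdeal k n) e).colon (testIdeal p f 1 : Set (Poly k n)) := by
  have hF := h.hypFrob (p := p)
  rw [fraction_pow, ← pow_succ, ← map_pow, toLaurent_mul_fraction] at hF
  rw [hF.eq_zero_iff hf0, fraction_univ_mem_supported_iff, ← pow_mul_pow_mem_frobPower_iff,
    frobPower_frobPower]

lemma eq_zero_of_hypFrob_eq_zero (hf : f.IsHomogeneous d) (hf0 : f ≠ 0) (hδ : IsDelta p f δ)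
    (hξ : ξ ∈ hypLCLT f n (δ + d)) (h0 : hypFrob p f n ξ = 0) : ξ = 0 := by
  obtain ⟨l, hconn, hdeg⟩ := exists_isConnecting_of_mem_LT hf hξ
  obtain ⟨e, g, rfl⟩ := exists_fraction_univ_eq p l
  have hcolon := (hypFrob_eq_zero_iff hf0 hconn).mp h0
  rw [hconn.eq_zero_iff hf0, fraction_univ_mem_supported_iff]
  rw [fraction_mem_supported_sum_iff] at hdeg
  by_contra hg
  obtain ⟨a, ha, hann⟩ :=
    exists_support_degree_sub_mem_annDegrees (isHomogeneous_testIdeal hf) hcolon hg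
  have hlt := hdeg a ha
  rw [Finset.card_fin, Set.mem_Iio, add_sub_cancel_right] at hlt
  have hle := (isDelta_iff_isLeast.mp hδ).2 hann
  push_cast at hlt
  linarith

lemma injOn_hypFrob (hf : f.IsHomogeneous d) (hf0 : f ≠ 0) (hδ : IsDelta p f δ) :
    Set.InjOn (hypFrob p f n) (hypLCLT f n (δ + d)) := by
  intro x hx y hy hxy
  refine sub_eq_zero.mp (eq_zero_of_hypFrob_eq_zero hf hf0 hδ (sub_mem hx hy) ?_)
  rw [hypFrob, map_sub, sub_eq_zero]
  exact hxy

lemma exists_hypFrob_eq_zero (hf : f.IsHomogeneous d) (hf0 : f ≠ 0) (hδ : IsDelta p f δ) :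
    ∃ ξ ∈ hypLCDegree f n (δ + d), ξ ≠ 0 ∧ hypFrob p f n ξ = 0 := by
  obtain ⟨e, s, ⟨g, hg, hcolon, hmem⟩, hs⟩ := (isDelta_iff_isLeast.mp hδ).1
  have hdeg : fraction Finset.univ (p ^ e) g ∈ supported k k {z | ∑ i, z i = δ + d - d} := by
    refine (fraction_mem_supported_sum_iff (S := {δ + d - d})).mpr fun a ha => ?_
    have hdeg : a.degree = s := (hg.degree_eq_sum_deg_support ha).symm
    rw [hdeg, ← hs, Finset.card_fin, Set.mem_singleton_iff]
    push_cast
    ring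
  have hfg : toLaurent f * fraction Finset.univ (p ^ e) g ∈
      supported k k {z | ∃ i, 0 ≤ z i} := by
    rw [toLaurent_mul_fraction, fraction_univ_mem_supported_iff, mul_comm]
    exact Submodule.mem_colon.mp hcolon f self_mem_testIdeal
  obtain ⟨ξ, hξ, hconn⟩ := exists_mem_degree_isConnecting hf hdeg hfg
  refine ⟨ξ, hξ, ?_, (hypFrob_eq_zero_iff hf0 hconn).mpr hcolon⟩
  rwa [Ne, hconn.eq_zero_iff hf0, fraction_univ_mem_supported_iff]

end FrobeniusKernel

end FPureHyp

end

theorem theorem2_general {k : Type*} [Field k] (p : ℕ) [Fact p.Prime] [CharP k p]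
    (n d : ℕ) (f : FPureHyp.Poly k n) (hf : f.IsHomogeneous d) :
    (FPureHyp.IsolatedNonFPure p f →
      ∃ δ : ℤ, FPureHyp.IsDelta p f δ ∧
        Set.MapsTo (FPureHyp.hypFrob p f n)
          (FPureHyp.hypLCLT f n (δ + d)) (FPureHyp.hypLCLT f n (p * (δ + d))) ∧
        Set.InjOn (FPureHyp.hypFrob p f n) (FPureHyp.hypLCLT f n (δ + d)) ∧
        ∃ ξ ∈ FPureHyp.hypLCDegree f n (δ + d), ξ ≠ 0 ∧ FPureHyp.hypFrob p f n ξ = 0) ∧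
    (∀ j : ℕ, 1 ≤ j → FPureHyp.testIdeal p f 1 = FPureHyp.maxIdeal k n ^ j →
      FPureHyp.IsolatedNonFPure p f ∧
        FPureHyp.IsDelta p f (-n - j) ∧
        Set.MapsTo (FPureHyp.hypFrob p f n)
          (FPureHyp.hypLCLT f n (-n - j + d)) (FPureHyp.hypLCLT f n (p * (-n - j + d))) ∧
        Set.InjOn (FPureHyp.hypFrob p f n) (FPureHyp.hypLCLT f n (-n - j + d))) := by
  refine ⟨fun hiso => ?_, fun j hj hτ => ?_⟩
  · obtain ⟨δ, hδ⟩ := hiso.exists_isDelta hf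
    exact ⟨δ, hδ, FPureHyp.hypFrob_mapsTo f n _, FPureHyp.injOn_hypFrob hf hiso.ne_zero hδ,
      FPureHyp.exists_hypFrob_eq_zero hf hiso.ne_zero hδ⟩
  · have hf0 := FPureHyp.ne_zero_of_testIdeal_eq hτ
    have hδ : FPureHyp.IsDelta p f (-n - j) := by
      rw [FPureHyp.isDelta_iff_isLeast, hτ]
      exact FPureHyp.isLeast_annDegrees_maxIdeal_pow hj
    exact ⟨FPureHyp.isolatedNonFPure_of_testIdeal_eq hj hτ, hδ, FPureHyp.hypFrob_mapsTo f n _,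
      FPureHyp.injOn_hypFrob hf hf0 hδ⟩

theorem theorem2 {k : Type*} [Field k] (p : ℕ) [Fact p.Prime] [CharP k p]
    (hk : (frobenius k p).Finite) (n d : ℕ) (f : FPureHyp.Poly k n) (hf : f.IsHomogeneous d) :
    (FPureHyp.IsolatedNonFPure p f →
      ∃ δ : ℤ, FPureHyp.IsDelta p f δ ∧
        Set.MapsTo (FPureHyp.hypFrob p f n)
          (FPureHyp.hypLCLT f n (δ + d)) (FPureHyp.hypLCLT f n (p * (δ + d))) ∧
        Set.InjOn (FPureHyp.hypFrob p f n) (FPureHyp.hypLCLT f n (δ + d)) ∧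
        ∃ ξ ∈ FPureHyp.hypLCDegree f n (δ + d), ξ ≠ 0 ∧ FPureHyp.hypFrob p f n ξ = 0) ∧
    (∀ j : ℕ, 1 ≤ j → FPureHyp.testIdeal p f 1 = FPureHyp.maxIdeal k n ^ j →
      FPureHyp.IsolatedNonFPure p f ∧
        FPureHyp.IsDelta p f (-n - j) ∧
        Set.MapsTo (FPureHyp.hypFrob p f n)
          (FPureHyp.hypLCLT f n (-n - j + d)) (FPureHyp.hypLCLT f n (p * (-n - j + d))) ∧
        Set.InjOn (FPureHyp.hypFrob p f n) (FPureHyp.hypLCLT f n (-n - j + d))) :=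
  theorem2_general p n d f hf
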